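/- Let $\alpha>1$ and $l>0$. The state of the game is $\mathbf x=(x_I,y_I,x_D,y_D)\in\mathbb R^4$, where $(x_I,y_I)$ is the position of the Intruder and $(x_D,y_D)$ that of the Defender, with dynamics $\dot x_I=\cos\phi$, $\dot y_I=\sin\phi$, $\dot x_D=\alpha\cos\psi$, $\dot y_D=\alpha\sin\psi$, where the Intruder chooses the heading $\phi\in[-\pi,\pi]$ and the Defender the heading $\psi\in[-\pi,\pi]$ (measurable in time). Let $\mathcal R=\{(x,y):y\le 0\}$ be the retreat region and put $$V_{\rm II}(\mathbf x)=\max_{\boldsymbol p\in\mathcal R}\bigl(|\boldsymbol p-(x_D,y_D)|-\alpha|\boldsymbol p-(x_I,y_I)|\bigr),\qquad \mathcal X_{\rm II}=\{\mathbf x: V_{\rm II}(\mathbf x)\ge 0\}$$ ($\mathcal X_{\rm II}$ is the set of states from which safe retreat is possible). In the approach game (Phase I) the Intruder also chooses a switching time $t_s\ge 0$. The payoff, which the Intruder minimizes and the Defender maximizes, is $J_{\rm I}=l-y_I(t_s)$, subject to the safe-retreat constraint that $\mathbf x(t)\in\mathcal X_{\rm II}$ for $0\le t\le t_s$ and $y_I(t)>0$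 for $0\le t<t_s$; if the Intruder violates this constraint or never switches, $J_{\rm I}=+\infty$. Let $$V_{\rm I}(\mathbf x)=l-\frac12\left(y_I+\sqrt{\frac{(x_I-x_D)^2}{\alpha^2-1}+\frac{y_D^2}{\alpha^2}}\right),\qquad \mathcal X_{\rm I}=\{\mathbf x\in\mathcal X_{\rm II}:V_{\rm I}(\mathbf x)\ge 0\},$$ $$\Lambda(\mathbf x)=\frac{\operatorname{sgn}(x_I-x_D)}{\sqrt{\alpha^2+\frac{(\alpha^2-1)^2}{\alpha^2}\frac{y_D^2}{(x_I-x_D)^2}}}\quad(\Lambda=0\text{ if }x_I=x_D),$$ $$\phi_{\rm I}^\star=\operatorname{atan2}\bigl(\sqrt{1-\Lambda^2},\Lambda\bigr),\qquad \psi_{\rm I}^\star=\operatorname{atan2}\bigl(-\operatorname{sgn}(y_D)\sqrt{1-\alpha^2\Lambda^2},\,\alpha\Lambda\bigr)$$ (so $\operatorname{sgn}(y_D)=1$ when the Defender is outside $\mathcal R$). Theorem. On $\mathcal X_{\rm I}\cap\{y_I>0\}$ the function $V_{\rm I}$ is the Value function of the approach game, and the state feedbacks $\phi_{\rm I}^\star$,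 with switching at the first time at which $V_{\rm II}(\mathbf x)=0$ or $y_I\ge l$, and $\psi_{\rm I}^\star$ are equilibrium strategies. That is, for every initial state $\mathbf x^0\in\mathcal X_{\rm I}$ with $y_I^0>0$: (i) each player can follow this strategy against every measurable control (and, for the Intruder as opponent, every choice of $t_s$, including never switching); every play in which the Intruder follows it has $J_{\rm I}\le V_{\rm I}(\mathbf x^0)$; every play in which the Defender follows it has $J_{\rm I}\ge V_{\rm I}(\mathbf x^0)$; there is a play in which both follow their strategies, and every such play has $J_{\rm I}=V_{\rm I}(\mathbf x^0)$; (ii) consequently $\min\max J_{\rm I}=\max\min J_{\rm I}=V_{\rm I}(\mathbf x^0)$ over all classes of state-feedback strategies that contain the two strategies above and in which every pair of strategies generates a play from $\mathbf x^0$; (iii) $V_{\rm I}$ is $C^1$ near $\mathbf x^0$ and satisfies there the Hamilton–Jacobi–Isaacs equation $\min_\phi\max_\psi\bigl\{\tfrac{\partial V_{\rm I}}{\partial\mathbf x}(\mathbf x^0)\cdot(\cos\phi,\sin\phi,\alpha\cos\psi,\alpha\sin\psi)\bigr\}=0$. -/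

import Mathlib

open Set MeasureTheory
open scoped Topology

noncomputable section

namespace Recon

/-- Game states `x = (x_I, y_I, x_D, y_D)`: coordinates `0, 1` are the position of the Intruder,
coordinates `2, 3` the position of the Defender. -/
abbrev State : Type := Fin 4 → ℝ

/-- The velocity of the game state (simple motion: the Intruder has speed `1`, the Defender speed
`α`) for the headings `φ` of the Intruder and `ψ` of the Defender. -/
def field (α φ ψ : ℝ) : State :=
  ![Real.cos φ, Real.sin φ, α * Real.cos ψ, α * Real.sin ψ]

/-- Headings are angles in `[-π, π]`. -/
def headings : Set ℝ := Icc (-Real.pi) Real.pi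

/-- `atan2 y x` is the angle in `(-π, π]` of the vector `(x, y)`. -/
def atan2 (y x : ℝ) : ℝ := Complex.arg ⟨x, y⟩

/-- The retreat region, the half-plane `y ≤ 0`. -/
def retreatRegion : Set (ℝ × ℝ) := {p | p.2 ≤ 0}

/-- `Δ(x, p) = |p - D| - α |p - I|`. -/
def Delta (α : ℝ) (x : State) (p : ℝ × ℝ) : ℝ :=
  Real.sqrt ((p.1 - x 2) ^ 2 + (p.2 - x 3) ^ 2) -
    α * Real.sqrt ((p.1 - x 0) ^ 2 + (p.2 - x 1) ^ 2)

/-- `V_II(x)`, the maximum of `Δ(x, p)` over the points `p` of the retreat region. -/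
def VII (α : ℝ) (x : State) : ℝ := sSup (Delta α x '' retreatRegion)

/-- `X_II`, the states from which the Intruder can retreat safely. -/
def XII (α : ℝ) : Set State := {x | 0 ≤ VII α x}

/-- The closed form `V_I`. -/
def VI (α l : ℝ) (x : State) : ℝ :=
  l - 1 / 2 * (x 1 + Real.sqrt ((x 0 - x 2) ^ 2 / (α ^ 2 - 1) + x 3 ^ 2 / α ^ 2))

/-- `X_I = {x ∈ X_II : V_I(x) ≥ 0}`. -/
def XI (α l : ℝ) : Set State := {x | x ∈ XII α ∧ 0 ≤ VI α l x}

/-- The quantity `Λ`, with the sign of `x_I - x_D`; it is `0` when `x_I = x_D`. -/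
def Lam (α : ℝ) (x : State) : ℝ :=
  Real.sign (x 0 - x 2) /
    Real.sqrt (α ^ 2 + (α ^ 2 - 1) ^ 2 / α ^ 2 * (x 3 ^ 2 / (x 0 - x 2) ^ 2))

/-- The equilibrium heading of the Intruder. -/
def phiStar (α : ℝ) (x : State) : ℝ :=
  atan2 (Real.sqrt (1 - Lam α x ^ 2)) (Lam α x)

/-- The equilibrium heading of the Defender; the sign of `y_D` is `1` when the Defender is outside
the retreat region. -/
def psiStar (α : ℝ) (x : State) : ℝ :=
  atan2 (-(Real.sign (x 3) * Real.sqrt (1 - α ^ 2 * Lam α x ^ 2))) (α * Lam α x)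

/-- A play of the approach game from `x0`: measurable headings `u` (Intruder) and `v` (Defender),
the resulting trajectory of the game state, and the time `ts` at which the Intruder switches from
approach to retreat (`⊤` if it never does). -/
structure Play (α : ℝ) (x0 : State) where
  u : ℝ → ℝ
  v : ℝ → ℝ
  traj : ℝ → State
  ts : WithTop ℝ
  measurable_u : Measurable u
  measurable_v : Measurable v
  u_mem : ∀ t, u t ∈ headings
  v_mem : ∀ t, v t ∈ headings
  traj_eq : ∀ t, 0 ≤ t → ∀ i, traj t i = x0 i + ∫ s in (0 : ℝ)..t, field α (u s) (v s) i
  ts_nonneg : 0 ≤ ts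

namespace Play

variable {α : ℝ} {x0 : State}

/-- The approach phase is still going on at time `t`: the Intruder has not switched yet, safe
retreat has been possible so far, and the Intruder has not entered the retreat region. -/
def Active (p : Play α x0) (t : ℝ) : Prop :=
  (t : WithTop ℝ) < p.ts ∧ ∀ s ∈ Icc 0 t, p.traj s ∈ XII α ∧ 0 < p.traj s 1

/-- The Intruder switches in time: it switches at all, no later than it enters the retreat region,
and safe retreat is possible at the switching time and at every time before. -/
def SwitchesSafely (p : Play α x0) : Prop :=
  p.ts ≠ ⊤ ∧
    (∀ s : ℝ, 0 ≤ s → (s : WithTop ℝ) ≤ p.ts → p.traj s ∈ XII α) ∧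
    (∀ s : ℝ, 0 ≤ s → (s : WithTop ℝ) < p.ts → 0 < p.traj s 1)

open Classical in
/-- The payoff (the Intruder minimizes, the Defender maximizes): `l - y_I` at the switching time,
and `+∞` if the Intruder violates the constraint. -/
def payoff (l : ℝ) (p : Play α x0) : EReal :=
  if p.SwitchesSafely then ((l - p.traj (p.ts.untopD 0) 1 : ℝ) : EReal) else ⊤

end Play

/-- A state-feedback strategy of the Intruder: a heading for every state, and the set of states in
which it switches to retreat. -/
structure IntruderStrategy where
  heading : State → ℝ
  switch : Set State

/-- A state-feedback strategy of the Defender. -/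
abbrev DefenderStrategy : Type := State → ℝ

/-- During the approach phase the Intruder uses the feedback heading, and it switches at the first
time at which the state is in the switching set. -/
def Play.IntruderFollows {α : ℝ} {x0 : State} (p : Play α x0) (σ : IntruderStrategy) : Prop :=
  (∀ᵐ t : ℝ, 0 ≤ t → p.Active t → p.u t = σ.heading (p.traj t)) ∧
    (∀ t : ℝ, p.ts = (t : WithTop ℝ) → p.traj t ∈ σ.switch) ∧
    (∀ t : ℝ, 0 ≤ t → (t : WithTop ℝ) < p.ts → p.traj t ∉ σ.switch)

/-- During the approach phase the Defender uses the feedback heading. -/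
def Play.DefenderFollows {α : ℝ} {x0 : State} (p : Play α x0) (ψ : DefenderStrategy) : Prop :=
  ∀ᵐ t : ℝ, 0 ≤ t → p.Active t → p.v t = ψ (p.traj t)

/-- The set of payoffs `J(σ, ψ; x0)` of the plays in which both players follow their strategies
(a discontinuous feedback may allow several plays, or none). -/
def outcomes (α l : ℝ) (x0 : State) (σ : IntruderStrategy) (ψ : DefenderStrategy) : Set EReal :=
  {c | ∃ p : Play α x0, p.IntruderFollows σ ∧ p.DefenderFollows ψ ∧ p.payoff l = c}

/-- `(σ, ψ)` is a saddle point at `x0` with payoff `V`. The opponent is allowed any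
measurable heading (and the Intruder any switching time), in particular any state feedback. -/
structure IsSaddlePoint (α l : ℝ) (x0 : State) (σ : IntruderStrategy) (ψ : DefenderStrategy)
    (V : ℝ) : Prop where
  /-- The Intruder can follow `σ` whatever the Defender does. -/
  intruder_play : ∀ v : ℝ → ℝ, Measurable v → (∀ t, v t ∈ headings) →
    ∃ p : Play α x0, p.v = v ∧ p.IntruderFollows σ
  /-- The Defender can follow `ψ` whatever the Intruder does. -/
  defender_play : ∀ (u : ℝ → ℝ) (ts : WithTop ℝ), Measurable u → (∀ t, u t ∈ headings) → 0 ≤ ts →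
    ∃ p : Play α x0, p.u = u ∧ p.ts = ts ∧ p.DefenderFollows ψ
  /-- `J(σ, ·) ≤ V`. -/
  intruder_le : ∀ p : Play α x0, p.IntruderFollows σ → p.payoff l ≤ (V : EReal)
  /-- `V ≤ J(·, ψ)`. -/
  le_defender : ∀ p : Play α x0, p.DefenderFollows ψ → (V : EReal) ≤ p.payoff l
  /-- `J(σ, ψ) = V`. -/
  outcomes_eq : outcomes α l x0 σ ψ = {(V : EReal)}

/-- `V` is the common value of min-max and max-min of the payoff at `x0`, when the players choose
their state feedbacks in the classes `𝓘` and `𝓓`. -/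
def IsValueOn (α l : ℝ) (x0 : State) (𝓘 : Set IntruderStrategy) (𝓓 : Set DefenderStrategy)
    (V : ℝ) : Prop :=
  (⨅ σ ∈ 𝓘, ⨆ ψ ∈ 𝓓, sSup (outcomes α l x0 σ ψ)) = (V : EReal) ∧
    (⨆ ψ ∈ 𝓓, ⨅ σ ∈ 𝓘, sInf (outcomes α l x0 σ ψ)) = (V : EReal)

/-- Classes of state feedbacks such that every pair of strategies has a play from `x0`. -/
def Compatible (α l : ℝ) (x0 : State) (𝓘 : Set IntruderStrategy) (𝓓 : Set DefenderStrategy) :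
    Prop :=
  ∀ σ ∈ 𝓘, ∀ ψ ∈ 𝓓, (outcomes α l x0 σ ψ).Nonempty

/-- The equilibrium strategy of the Intruder: heading `φ*`, switching when safe retreat is about to
become impossible or the target half-plane `y ≥ l` is reached. -/
def sigmaStar (α l : ℝ) : IntruderStrategy where
  heading := phiStar α
  switch := {x | VII α x = 0 ∨ l ≤ x 1}

/-- The stationary Hamilton-Jacobi-Isaacs equation `min_φ max_ψ DV(x) f(φ, ψ) = 0` at `x`. -/
def HJI (α : ℝ) (V : State → ℝ) (x : State) : Prop :=
  IsLeast {m : ℝ | ∃ φ ∈ headings,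
    IsGreatest ((fun ψ => fderiv ℝ V x (field α φ ψ)) '' headings) m} 0

end Recon

end

/-! For y_I > 0, completing squares in the retreat point shows that safe retreat is possible iff y_I
≤ `spread`, and that `VII` vanishes exactly when y_I = `spread` (`mem_XII_iff`, `VII_eq_zero_iff`).
Since `VI` is l − (y_I + `spread`)/2, it equals the payoff l − y_I on that critical surface and is
at most the payoff at every safe state.

Along a trajectory the derivative of `VI` is (`defenderRate` − `intruderRate`)/(2 `spread`). Each
rate is the scalar product of a state vector with the player's unit heading, and `sq_norm_zeta` says
that the two vectors have the same length up to the common factor. Each player maximizes its rate by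
its starred heading, and the maxima cancel: this is the Isaacs equation. Integrated, `VI` cannot
increase while the Intruder follows `phiStar` (`VI_traj_le`) and cannot decrease while the Defender
follows `psiStar` (`le_VI_traj`). Comparing `VI` with the payoff at the switching time gives both
saddle inequalities; `phiStar` has vertical speed bounded below, so the Intruder does switch.

It remains to produce plays. Against an arbitrary measurable opponent, the feedback equation is
solved by Picard–Lindelöf after truncating the normalization of `zeta` near 0; the safety constraint
keeps `zeta` away from the truncated region. When both players follow their feedbacks, the headings
are constant and the play is explicit (`exists_play_both`). -/

namespace Recon

/-! ### Integral equations on time intervals, first exit times, and truncated normalization. -/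

section Analysis

variable {E : Type*} [NormedAddCommGroup E] [NormedSpace ℝ E]

/-- An interval of times starting at `0`. -/
structure IsTimeInterval (A : Set ℝ) : Prop where
  nonneg : ∀ t ∈ A, 0 ≤ t
  down : ∀ t ∈ A, ∀ s, 0 ≤ s → s ≤ t → s ∈ A

theorem IsTimeInterval.Icc_subset {A : Set ℝ} (hA : IsTimeInterval A) {t : ℝ} (ht : t ∈ A) :
    Icc 0 t ⊆ A := fun s hs => hA.down t ht s hs.1 hs.2

theorem IsTimeInterval.measurableSet {A : Set ℝ} (hA : IsTimeInterval A) : MeasurableSet A := by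
  have : A.OrdConnected := ⟨fun a ha b hb s hs => hA.down b hb s ((hA.nonneg a ha).trans hs.1) hs.2⟩
  exact this.measurableSet

/-- A point of `A` either lies below a later point of `A` or is the maximum of `A`; in both cases
some `Icc 0 T` is a neighbourhood of it within `A`. -/
theorem IsTimeInterval.continuousOn {X : Type*} [TopologicalSpace X] {A : Set ℝ}
    (hA : IsTimeInterval A) {g : ℝ → X} (h : ∀ T ∈ A, ContinuousOn g (Icc 0 T)) :
    ContinuousOn g A := by
  intro t ht
  by_cases hmax : ∃ T ∈ A, t < T
  · obtain ⟨T, hT, htT⟩ := hmax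
    refine ((h T hT) t ⟨hA.nonneg t ht, htT.le⟩).mono_of_mem_nhdsWithin ?_
    filter_upwards [self_mem_nhdsWithin, mem_nhdsWithin_of_mem_nhds (Iio_mem_nhds htT)] with s hs hsT
    exact ⟨hA.nonneg s hs, le_of_lt hsT⟩
  · push Not at hmax
    exact ((h t ht) t ⟨hA.nonneg t ht, le_rfl⟩).mono fun s hs => ⟨hA.nonneg s hs, hmax s hs⟩

theorem continuousOn_comp_of_lipschitzWith {E : Type*} [PseudoEMetricSpace E] {f : ℝ → E → E} {K : NNReal} {s : Set ℝ} {q : ℝ → E}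
    (hL : ∀ t ∈ s, LipschitzWith K (f t)) (hc : ∀ x, ContinuousOn (f · x) s)
    (hq : ContinuousOn q s) : ContinuousOn (fun t => f t (q t)) s := by
  have h : ContinuousOn (Function.uncurry f) (s ×ˢ univ) :=
    continuousOn_prod_of_continuousOn_lipschitzOnWith' _ K
      (fun t ht => (hL t ht).lipschitzOnWith) (fun x _ => hc x)
  exact h.comp (continuousOn_id.prodMk hq) fun t ht => ⟨ht, mem_univ _⟩

theorem hasDerivWithinAt_integral_of_continuousOn_Icc [CompleteSpace E] {g : ℝ → E} {T t : ℝ}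
    (hg : ContinuousOn g (Icc 0 T)) (ht : t ∈ Ico 0 T) :
    HasDerivWithinAt (fun s => ∫ r in (0 : ℝ)..s, g r) (g t) (Ici t) t := by
  have hi : IntervalIntegrable g volume 0 t := by
    refine ContinuousOn.intervalIntegrable (hg.mono ?_)
    rw [uIcc_of_le ht.1]
    exact Icc_subset_Icc_right ht.2.le
  have hcw : ContinuousWithinAt g (Ioi t) t :=
    (hg t ⟨ht.1, ht.2.le⟩).mono_of_mem_nhdsWithin (by
      filter_upwards [self_mem_nhdsWithin, mem_nhdsWithin_of_mem_nhds (Iio_mem_nhds ht.2)]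
        with s hs hsT
      exact ⟨ht.1.trans (le_of_lt hs), le_of_lt hsT⟩)
  refine intervalIntegral.integral_hasDerivWithinAt_right hi ?_ hcw
  refine ⟨Icc t T, ?_, (hg.mono (Icc_subset_Icc_left ht.1)).aestronglyMeasurable measurableSet_Icc⟩
  filter_upwards [self_mem_nhdsWithin, mem_nhdsWithin_of_mem_nhds (Iio_mem_nhds ht.2)] with s hs hsT
  exact ⟨le_of_lt hs, le_of_lt hsT⟩

theorem exists_integral_solution_Icc [CompleteSpace E] {f : ℝ → E → E} {T : ℝ} (hT : 0 ≤ T)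
    {M K : NNReal} (hM : ∀ t x, ‖f t x‖ ≤ M) (hL : ∀ t ∈ Icc 0 T, LipschitzWith K (f t))
    (hc : ∀ x, ContinuousOn (f · x) (Icc 0 T)) (q0 : E) :
    ∃ q : ℝ → E, ContinuousOn q (Icc 0 T) ∧
      ∀ t ∈ Icc 0 T, q t = q0 + ∫ s in (0 : ℝ)..t, f s (q s) := by
  -- The field is bounded by `M` everywhere, so a ball of radius `M * T` is not left before time `T`
  -- and the local theorem covers the whole interval.
  have hPL : IsPicardLindelof f (⟨0, ⟨le_rfl, hT⟩⟩ : Icc 0 T) q0 (M * T.toNNReal) 0 M K :=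
    { lipschitzOnWith := fun t ht => (hL t ht).lipschitzOnWith
      continuousOn := fun x _ => hc x
      norm_le := fun t _ x _ => hM t x
      mul_max_le := by simp [hT] }
  obtain ⟨q, hq0, hq⟩ := hPL.exists_eq_forall_mem_Icc_hasDerivWithinAt₀
  have hqc : ContinuousOn q (Icc 0 T) := fun t ht => (hq t ht).continuousWithinAt
  have hfc := continuousOn_comp_of_lipschitzWith hL hc hqc
  refine ⟨q, hqc, fun t ht => ?_⟩
  have hsub : Icc 0 t ⊆ Icc 0 T := Icc_subset_Icc_right ht.2
  have := intervalIntegral.integral_eq_sub_of_hasDeriv_right_of_le ht.1 (hqc.mono hsub)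
    (f' := fun s => f s (q s)) (fun s hs => ?_) ?_
  · rw [this]; simp only at hq0; rw [hq0]; abel
  · refine (hq s (hsub (Ioo_subset_Icc_self hs))).mono_of_mem_nhdsWithin ?_
    exact mem_nhdsWithin_of_mem_nhds (Icc_mem_nhds hs.1 (hs.2.trans_le ht.2))
  · exact ContinuousOn.intervalIntegrable (by rw [uIcc_of_le ht.1]; exact hfc.mono hsub)

theorem integral_solution_unique [CompleteSpace E] {f : ℝ → E → E} {T : ℝ}
    {K : NNReal} (hL : ∀ t ∈ Icc 0 T, LipschitzWith K (f t))
    (hc : ∀ x, ContinuousOn (f · x) (Icc 0 T)) {q0 : E} {q p : ℝ → E}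
    (hqc : ContinuousOn q (Icc 0 T)) (hpc : ContinuousOn p (Icc 0 T))
    (hq : ∀ t ∈ Icc 0 T, q t = q0 + ∫ s in (0 : ℝ)..t, f s (q s))
    (hp : ∀ t ∈ Icc 0 T, p t = q0 + ∫ s in (0 : ℝ)..t, f s (p s)) :
    EqOn q p (Icc 0 T) := by
  rcases lt_or_ge T 0 with hT | hT
  · simp [Icc_eq_empty_of_lt hT]
  have key : ∀ q : ℝ → E, ContinuousOn q (Icc 0 T) →
      (∀ t ∈ Icc 0 T, q t = q0 + ∫ s in (0 : ℝ)..t, f s (q s)) →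
      ∀ t ∈ Ico 0 T, HasDerivWithinAt q (f t (q t)) (Ici t) t := by
    intro q hqc hq t ht
    have h := (hasDerivWithinAt_integral_of_continuousOn_Icc
      (continuousOn_comp_of_lipschitzWith hL hc hqc) ht).const_add q0
    refine h.congr_of_eventuallyEq ?_ (hq t ⟨ht.1, ht.2.le⟩)
    filter_upwards [self_mem_nhdsWithin, mem_nhdsWithin_of_mem_nhds (Iio_mem_nhds ht.2)]
      with s hs hsT
    exact hq s ⟨ht.1.trans hs, le_of_lt hsT⟩
  refine ODE_solution_unique_of_mem_Icc_right (v := f) (s := fun _ => univ) (K := K)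
    (fun t ht => (hL t ⟨ht.1, ht.2.le⟩).lipschitzOnWith) hqc (key q hqc hq) (fun _ _ => mem_univ _)
    hpc (key p hpc hp) (fun _ _ => mem_univ _) ?_
  rw [hq 0 ⟨le_rfl, hT⟩, hp 0 ⟨le_rfl, hT⟩]
  simp

/-- A bounded vector field that is uniformly Lipschitz on every compact part of a time interval has
a solution on the whole interval. -/
theorem exists_integral_solution [CompleteSpace E] {A : Set ℝ} (hA : IsTimeInterval A)
    {f : ℝ → E → E} {M : NNReal} (hM : ∀ t x, ‖f t x‖ ≤ M)
    (hL : ∀ T ∈ A, ∃ K : NNReal, ∀ t ∈ Icc 0 T, LipschitzWith K (f t))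
    (hc : ∀ x, ContinuousOn (f · x) A) (q0 : E) :
    ∃ q : ℝ → E, ContinuousOn q A ∧ ContinuousOn (fun t => f t (q t)) A ∧
      ∀ t ∈ A, q t = q0 + ∫ s in (0 : ℝ)..t, f s (q s) := by
  have hex : ∀ T : A, ∃ q : ℝ → E, ContinuousOn q (Icc 0 (T : ℝ)) ∧
      ∀ t ∈ Icc 0 (T : ℝ), q t = q0 + ∫ s in (0 : ℝ)..t, f s (q s) := fun T => by
    obtain ⟨K, hK⟩ := hL T T.2
    exact exists_integral_solution_Icc (hA.nonneg T T.2) hM hK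
      (fun x => (hc x).mono (hA.Icc_subset T.2)) q0
  choose Q hQc hQ using hex
  have hcoh : ∀ S T : A, (S : ℝ) ≤ T → EqOn (Q S) (Q T) (Icc 0 (S : ℝ)) := fun S T hST => by
    obtain ⟨K, hK⟩ := hL S S.2
    have hsub : Icc 0 (S : ℝ) ⊆ Icc 0 (T : ℝ) := Icc_subset_Icc_right hST
    exact integral_solution_unique hK (fun x => (hc x).mono (hA.Icc_subset S.2)) (hQc S)
      ((hQc T).mono hsub) (hQ S) (fun t ht => hQ T t (hsub ht))
  classical
  -- The solution with horizon `t` is evaluated at `t` itself; uniqueness makes the horizons agree.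
  let q : ℝ → E := fun t => if h : t ∈ A then Q ⟨t, h⟩ t else 0
  have hq : ∀ T : A, EqOn q (Q T) (Icc 0 (T : ℝ)) := fun T t ht => by
    have htA : t ∈ A := hA.Icc_subset T.2 ht
    simp only [q, htA, dif_pos]
    exact hcoh ⟨t, htA⟩ T ht.2 ⟨ht.1, le_rfl⟩
  have hqc : ∀ T ∈ A, ContinuousOn q (Icc 0 T) := fun T hT => (hQc ⟨T, hT⟩).congr (hq ⟨T, hT⟩)
  refine ⟨q, hA.continuousOn hqc, hA.continuousOn fun T hT => ?_, fun t ht => ?_⟩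
  · obtain ⟨K, hK⟩ := hL T hT
    exact continuousOn_comp_of_lipschitzWith hK (fun x => (hc x).mono (hA.Icc_subset hT))
      (hqc T hT)
  · have h0 := hA.nonneg t ht
    rw [hq ⟨t, ht⟩ ⟨h0, le_rfl⟩, hQ ⟨t, ht⟩ t ⟨h0, le_rfl⟩]
    congr 1
    refine intervalIntegral.integral_congr fun s hs => ?_
    rw [uIcc_of_le h0] at hs
    simp only [hq ⟨t, ht⟩ hs]

/-- A continuous function that cannot reach `0` for the first time stays positive. -/
theorem pos_of_forall_first_exit {g : ℝ → ℝ} {T : ℝ} (hg : ContinuousOn g (Icc 0 T))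
    (h : ∀ t ∈ Icc 0 T, (∀ s ∈ Ico 0 t, 0 < g s) → 0 < g t) : ∀ t ∈ Icc 0 T, 0 < g t := by
  by_contra! hbad
  obtain ⟨t, ht, hgt⟩ := hbad
  have hB : IsCompact (Icc 0 T ∩ g ⁻¹' Iic 0) :=
    isCompact_Icc.of_isClosed_subset
      (hg.preimage_isClosed_of_isClosed isClosed_Icc isClosed_Iic) inter_subset_left
  obtain ⟨r, ⟨hr, hgr⟩, hmin⟩ := hB.exists_isLeast ⟨t, ht, hgt⟩
  refine absurd hgr (not_le.2 (h r hr fun s hs => ?_))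
  by_contra! hs'
  exact absurd (hmin ⟨⟨hs.1, hs.2.le.trans hr.2⟩, hs'⟩) (not_le.2 hs.2)

/-- Controls are only measurable, so derivatives exist only almost everywhere; the Lipschitz bound
gives absolute continuity, hence the fundamental theorem of calculus. -/
theorem le_of_lipschitzOnWith_of_ae_deriv_nonpos {g : ℝ → ℝ} {T : ℝ} (hT : 0 ≤ T) {K : NNReal}
    (hg : LipschitzOnWith K g (Icc 0 T))
    (hd : ∀ᵐ t, t ∈ Ioo 0 T → ∃ d ≤ 0, HasDerivAt g d t) : g T ≤ g 0 := by
  have hac : AbsolutelyContinuousOnInterval g 0 T :=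
    LipschitzOnWith.absolutelyContinuousOnInterval (K := K) (by rwa [uIcc_of_le hT])
  have h := hac.integral_deriv_eq_sub
  have h2 : 0 ≤ ∫ t in (0 : ℝ)..T, -deriv g t := by
    refine intervalIntegral.integral_nonneg_of_ae_restrict hT ?_
    rw [Filter.EventuallyLE, ae_restrict_iff' measurableSet_Icc]
    filter_upwards [hd, Measure.ae_ne volume (0 : ℝ), Measure.ae_ne volume T] with t h h0 hT' ht
    obtain ⟨d, hd, hdt⟩ := h ⟨lt_of_le_of_ne ht.1 (Ne.symm h0), lt_of_le_of_ne ht.2 hT'⟩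
    rw [hdt.deriv]
    simpa using hd
  rw [intervalIntegral.integral_neg, h] at h2
  linarith

/-- The radial retraction `x ↦ x / max ε ‖x‖` is bounded by `1`. -/
theorem norm_inv_max_smul_le (ε : ℝ) (x : E) : ‖(max ε ‖x‖)⁻¹ • x‖ ≤ 1 := by
  rw [norm_smul, norm_inv, Real.norm_eq_abs, abs_of_nonneg ((norm_nonneg x).trans (le_max_right _ _)),
    inv_mul_eq_div]
  exact div_le_one_of_le₀ (le_max_right _ _) ((norm_nonneg x).trans (le_max_right _ _))

/-- This map is the Lipschitz substitute for x / ‖x‖ in the feedback equations; the two agree where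
ε ≤ ‖x‖. -/
theorem lipschitzWith_inv_max_smul {ε : ℝ} (hε : 0 < ε) :
    LipschitzWith (2 / ε).toNNReal fun x : E => (max ε ‖x‖)⁻¹ • x := by
  refine LipschitzWith.of_dist_le_mul fun x y => ?_
  rw [Real.coe_toNNReal _ (by positivity), dist_eq_norm, dist_eq_norm]
  set a := max ε ‖x‖
  set b := max ε ‖y‖
  have ha : ε ≤ a := le_max_left _ _
  have hb : ε ≤ b := le_max_left _ _
  have ha0 := hε.trans_le ha
  have hb0 := hε.trans_le hb
  have hyb : ‖y‖ ≤ b := le_max_right _ _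
  have hab : |b - a| ≤ ‖x - y‖ := by
    have h := abs_max_sub_max_le_abs ‖y‖ ‖x‖ ε
    rw [max_comm _ ε, max_comm _ ε] at h
    exact h.trans ((abs_norm_sub_norm_le y x).trans_eq (norm_sub_rev y x))
  have heq : a⁻¹ • x - b⁻¹ • y = a⁻¹ • (x - y) + ((b - a) / (a * b)) • y := by
    rw [smul_sub, sub_add, ← sub_smul]
    congr 2
    field_simp
    ring
  rw [heq]
  refine (norm_add_le _ _).trans ?_
  rw [norm_smul, norm_smul, Real.norm_eq_abs, Real.norm_eq_abs, abs_of_pos (inv_pos.2 ha0),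
    abs_div, abs_of_pos (mul_pos ha0 hb0)]
  have h1 : a⁻¹ * ‖x - y‖ ≤ ε⁻¹ * ‖x - y‖ := by gcongr
  have h2 : |b - a| / (a * b) * ‖y‖ ≤ ε⁻¹ * ‖x - y‖ := by
    calc |b - a| / (a * b) * ‖y‖ ≤ |b - a| / (a * b) * b := by gcongr
      _ = a⁻¹ * |b - a| := by field_simp
      _ ≤ ε⁻¹ * ‖x - y‖ := by gcongr
  calc _ ≤ ε⁻¹ * ‖x - y‖ + ε⁻¹ * ‖x - y‖ := add_le_add h1 h2
    _ = 2 / ε * ‖x - y‖ := by ring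

end Analysis

end Recon

noncomputable section

namespace Recon

/-! ### The functions `spread` and `zeta`. -/

/-- The weighted distance of the two players that enters `VI`. -/
def spread (α : ℝ) (x : State) : ℝ :=
  Real.sqrt ((x 0 - x 2) ^ 2 / (α ^ 2 - 1) + x 3 ^ 2 / α ^ 2)

/-- The complex number whose argument is the equilibrium heading of the Defender. -/
def zeta (α : ℝ) (x : State) : ℂ := ⟨α * (x 0 - x 2), -((α ^ 2 - 1) / α * x 3)⟩

theorem VI_eq (α l : ℝ) (x : State) : VI α l x = l - 1 / 2 * (x 1 + spread α x) := rfl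

theorem sq_sub_one_pos {α : ℝ} (hα : 1 < α) : 0 < α ^ 2 - 1 := by nlinarith

theorem spread_nonneg (α : ℝ) (x : State) : 0 ≤ spread α x := Real.sqrt_nonneg _

theorem spread_sq {α : ℝ} (hα : 1 < α) (x : State) :
    spread α x ^ 2 = (x 0 - x 2) ^ 2 / (α ^ 2 - 1) + x 3 ^ 2 / α ^ 2 := by
  have := sq_sub_one_pos hα
  exact Real.sq_sqrt (by positivity)

/-- The right side is the squared length of the vector (x_I − x_D, (α² − 1) `spread`) that the
Intruder's heading is paired with, so both players have the same optimal rate. -/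
theorem sq_norm_zeta {α : ℝ} (hα : 1 < α) (x : State) :
    ‖zeta α x‖ ^ 2 = (α ^ 2 - 1) ^ 2 * spread α x ^ 2 + (x 0 - x 2) ^ 2 := by
  have h1 := sq_sub_one_pos hα
  have h0 : α ≠ 0 := by positivity
  rw [Complex.sq_norm, Complex.normSq_apply, spread_sq hα]
  simp only [zeta]
  field_simp
  ring

theorem spread_le_norm_zeta {α : ℝ} (hα : 1 < α) (x : State) :
    (α ^ 2 - 1) * spread α x ≤ ‖zeta α x‖ := by
  refine abs_le_of_sq_le_sq' ?_ (norm_nonneg _) |>.2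
  rw [sq_norm_zeta hα]
  nlinarith [sq_nonneg (x 0 - x 2)]

theorem norm_zeta_pos {α : ℝ} (hα : 1 < α) {x : State} (hx : 0 < spread α x) :
    0 < ‖zeta α x‖ :=
  (mul_pos (sq_sub_one_pos hα) hx).trans_le (spread_le_norm_zeta hα x)

theorem continuous_spread (α : ℝ) : Continuous (spread α) := by
  unfold spread; fun_prop

/-- `spread` is the norm of a vector depending linearly on the state. The bound holds also where
`spread` vanishes and is not differentiable. -/
theorem abs_spread_sub_le {α : ℝ} (hα : 1 < α) (x y : State) :
    |spread α x - spread α y| ≤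
      (|x 0 - y 0| + |x 2 - y 2|) / Real.sqrt (α ^ 2 - 1) + |x 3 - y 3| / α := by
  have hb := sq_sub_one_pos hα
  have h0 : 0 < α := by linarith
  have hs := Real.sqrt_pos.2 hb
  have hn : ∀ z : State, spread α z = ‖(⟨(z 0 - z 2) / Real.sqrt (α ^ 2 - 1), z 3 / α⟩ : ℂ)‖ := by
    intro z
    rw [spread, Complex.norm_def, Complex.normSq_apply]
    congr 1
    simp only [← sq, div_pow, Real.sq_sqrt hb.le]
  rw [hn, hn]
  refine (abs_norm_sub_norm_le _ _).trans ((Complex.norm_le_abs_re_add_abs_im _).trans ?_)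
  simp only [Complex.sub_re, Complex.sub_im, ← sub_div, abs_div, abs_of_pos hs, abs_of_pos h0]
  gcongr
  rw [show x 0 - x 2 - (y 0 - y 2) = (x 0 - y 0) - (x 2 - y 2) by ring]
  exact abs_sub _ _

/-! ### The value of the retreat game -/

theorem bddAbove_Delta {α : ℝ} (hα : 1 < α) (x : State) :
    BddAbove (Delta α x '' retreatRegion) := by
  refine ⟨‖(⟨x 0 - x 2, x 1 - x 3⟩ : ℂ)‖, ?_⟩
  rintro _ ⟨p, -, rfl⟩
  have h1 : ∀ a b : ℝ, Real.sqrt (a ^ 2 + b ^ 2) = ‖(⟨a, b⟩ : ℂ)‖ := fun a b => by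
    rw [Complex.norm_def, Complex.normSq_apply, sq, sq]
  rw [Delta, h1, h1]
  have h2 : (⟨p.1 - x 2, p.2 - x 3⟩ : ℂ) =
      ⟨p.1 - x 0, p.2 - x 1⟩ + ⟨x 0 - x 2, x 1 - x 3⟩ := by
    apply Complex.ext <;> simp
  rw [h2]
  have := norm_add_le (⟨p.1 - x 0, p.2 - x 1⟩ : ℂ) ⟨x 0 - x 2, x 1 - x 3⟩
  nlinarith [norm_nonneg (⟨p.1 - x 0, p.2 - x 1⟩ : ℂ)]

theorem Delta_nonpos {α : ℝ} (hα : 1 < α) {x : State} (h1 : 0 < x 1) (hx : spread α x ≤ x 1)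
    {p : ℝ × ℝ} (hp : p ∈ retreatRegion) : Delta α x p ≤ 0 := by
  have hb := sq_sub_one_pos hα
  have h0 : 0 < α := by linarith
  have hp : p.2 ≤ 0 := hp
  have hsq : (x 0 - x 2) ^ 2 / (α ^ 2 - 1) + x 3 ^ 2 / α ^ 2 ≤ x 1 ^ 2 := by
    rw [← spread_sq hα]
    exact pow_le_pow_left₀ (spread_nonneg _ _) hx 2
  set d := (x 0 - x 2) / (α ^ 2 - 1) with hd
  have hdx : x 0 - x 2 = (α ^ 2 - 1) * d := by rw [hd]; field_simp
  have hsq' : α ^ 2 * ((α ^ 2 - 1) * d ^ 2) + x 3 ^ 2 ≤ α ^ 2 * x 1 ^ 2 := by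
    have h := mul_le_mul_of_nonneg_left hsq (sq_nonneg α)
    rw [hdx] at h
    refine le_trans (le_of_eq ?_) h
    field_simp
  have h3 : x 3 ≤ α * x 1 := by
    refine abs_le_of_sq_le_sq' ?_ (by positivity) |>.2
    nlinarith [mul_nonneg (sq_nonneg α) (mul_nonneg hb.le (sq_nonneg d))]
  have h3' : x 3 ≤ α ^ 2 * x 1 := by nlinarith [mul_pos h0 h1]
  rw [Delta, sub_nonpos, Real.sqrt_le_left (by positivity), mul_pow, Real.sq_sqrt (by positivity)]
  have hx2 : p.1 - x 2 = (p.1 - x 0) + (α ^ 2 - 1) * d := by rw [← hdx]; ring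
  rw [hx2]
  -- α²|p − I|² − |p − D|² equals (α² − 1)(p₁ − x_I − d)² + (α² − 1)p₂² − 2p₂(α²y_I − y_D) + α²(y_I²
  -- − `spread`²), and every term is nonnegative.
  nlinarith [mul_nonneg hb.le (sq_nonneg (p.1 - x 0 - d)), mul_nonneg hb.le (sq_nonneg p.2),
    mul_nonneg (neg_nonneg.2 hp) (sub_nonneg.2 h3')]

/-- The foot point `(x_I + (x_I - x_D) / (α² - 1), 0)` is the best retreat point in the critical
case. -/
theorem sq_sub_sq_foot {α : ℝ} (hα : 1 < α) (x : State) :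
    ((x 0 + (x 0 - x 2) / (α ^ 2 - 1) - x 2) ^ 2 + (0 - x 3) ^ 2) -
      α ^ 2 * ((x 0 + (x 0 - x 2) / (α ^ 2 - 1) - x 0) ^ 2 + (0 - x 1) ^ 2) =
      α ^ 2 * (spread α x ^ 2 - x 1 ^ 2) := by
  have hb := sq_sub_one_pos hα
  have h0 : α ≠ 0 := by positivity
  rw [spread_sq hα]
  field_simp
  ring

theorem le_VII {α : ℝ} (hα : 1 < α) (x : State) {p : ℝ × ℝ} (hp : p ∈ retreatRegion) :
    Delta α x p ≤ VII α x := le_csSup (bddAbove_Delta hα x) (mem_image_of_mem _ hp)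

/-- With `a` and `b` nonnegative, the sign of `a - b` is that of `a ^ 2 - b ^ 2`. -/
theorem Delta_foot {α : ℝ} (hα : 1 < α) (x : State) :
    ∃ p ∈ retreatRegion, ∃ a b : ℝ, 0 ≤ a ∧ 0 ≤ b ∧ Delta α x p = a - b ∧
      a ^ 2 - b ^ 2 = α ^ 2 * (spread α x ^ 2 - x 1 ^ 2) := by
  refine ⟨(x 0 + (x 0 - x 2) / (α ^ 2 - 1), 0), le_refl (0 : ℝ), _, _, Real.sqrt_nonneg _,
    mul_nonneg (by linarith) (Real.sqrt_nonneg _), rfl, ?_⟩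
  rw [← sq_sub_sq_foot hα, mul_pow, Real.sq_sqrt (by positivity), Real.sq_sqrt (by positivity)]

theorem VII_pos {α : ℝ} (hα : 1 < α) {x : State} (h1 : 0 < x 1) (hx : x 1 < spread α x) :
    0 < VII α x := by
  obtain ⟨p, hp, a, b, ha, hb, hD, hab⟩ := Delta_foot hα x
  refine lt_of_lt_of_le ?_ (le_VII hα x hp)
  rw [hD]
  have : 0 < α ^ 2 * (spread α x ^ 2 - x 1 ^ 2) :=
    mul_pos (by positivity) (by nlinarith)
  nlinarith

theorem VII_eq_zero {α : ℝ} (hα : 1 < α) {x : State} (h1 : 0 < x 1) (hx : x 1 = spread α x) :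
    VII α x = 0 := by
  apply le_antisymm
  · refine csSup_le ⟨_, mem_image_of_mem _ (show ((0, 0) : ℝ × ℝ) ∈ retreatRegion from le_refl (0 : ℝ))⟩ ?_
    rintro _ ⟨p, hp, rfl⟩
    exact Delta_nonpos hα h1 hx.ge hp
  · obtain ⟨p, hp, a, b, ha, hb, hD, hab⟩ := Delta_foot hα x
    refine le_trans ?_ (le_VII hα x hp)
    rw [hD]
    rw [← hx, sub_self, mul_zero] at hab
    nlinarith

/-- Pointwise negativity does not bound a supremum over an unbounded region away from 0. Lowering α
slightly to β keeps `spread` below y_I, and the difference leaves the uniform slack (α − β)|p − I| ≥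
(α − β)y_I. -/
theorem VII_neg {α : ℝ} (hα : 1 < α) {x : State} (h1 : 0 < x 1) (hx : spread α x < x 1) :
    VII α x < 0 := by
  have hb := sq_sub_one_pos hα
  have hcont : ContinuousAt (fun β => spread β x) α := by
    unfold spread
    have : α ≠ 0 := by positivity
    fun_prop (disch := positivity)
  obtain ⟨β, hβ, hβ1, hβα⟩ : ∃ β, spread β x < x 1 ∧ 1 < β ∧ β < α := by
    have h := (hcont.eventually_lt_const hx).and (lt_mem_nhds hα)
    have h' : ∀ᶠ β in 𝓝[<] α, (spread β x < x 1 ∧ 1 < β) ∧ β < α :=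
      (h.filter_mono nhdsWithin_le_nhds).and self_mem_nhdsWithin
    obtain ⟨β, ⟨h1, h2⟩, h3⟩ := h'.exists
    exact ⟨β, h1, h2, h3⟩
  have hneg : -((α - β) * x 1) < 0 := neg_neg_of_pos (mul_pos (sub_pos.2 hβα) h1)
  refine lt_of_le_of_lt (csSup_le ⟨_, mem_image_of_mem _
    (show ((0, 0) : ℝ × ℝ) ∈ retreatRegion from le_refl (0 : ℝ))⟩ ?_) hneg
  rintro _ ⟨p, hp, rfl⟩
  have h := Delta_nonpos hβ1 h1 hβ.le hp
  have hp : p.2 ≤ 0 := hp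
  have hI : x 1 ≤ Real.sqrt ((p.1 - x 0) ^ 2 + (p.2 - x 1) ^ 2) := by
    apply Real.le_sqrt_of_sq_le
    nlinarith [sq_nonneg (p.1 - x 0)]
  unfold Delta at h ⊢
  nlinarith [mul_le_mul_of_nonneg_left hI (sub_pos.2 hβα).le]

theorem mem_XII_iff {α : ℝ} (hα : 1 < α) {x : State} (h1 : 0 < x 1) :
    x ∈ XII α ↔ x 1 ≤ spread α x := by
  constructor
  · intro h
    by_contra! hlt
    exact absurd h (not_le.2 (VII_neg hα h1 hlt))
  · intro h
    rcases h.lt_or_eq with h | h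
    · exact (VII_pos hα h1 h).le
    · exact (VII_eq_zero hα h1 h).ge

/-- The case y_I ≤ 0 is included for the switching time, at which positivity is not imposed. -/
theorem le_spread_of_mem_XII {α : ℝ} (hα : 1 < α) {x : State} (hx : x ∈ XII α) :
    x 1 ≤ spread α x := by
  rcases le_or_gt (x 1) 0 with h | h
  · exact h.trans (spread_nonneg _ _)
  · exact (mem_XII_iff hα h).1 hx

theorem VII_eq_zero_iff {α : ℝ} (hα : 1 < α) {x : State} (h1 : 0 < x 1) :
    VII α x = 0 ↔ x 1 = spread α x := by
  refine ⟨fun h => ?_, VII_eq_zero hα h1⟩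
  rcases lt_trichotomy (x 1) (spread α x) with h' | h' | h'
  · exact absurd h (VII_pos hα h1 h').ne'
  · exact h'
  · exact absurd h (VII_neg hα h1 h').ne

/-! ### The equilibrium headings -/

theorem cos_atan2 {a b : ℝ} (h : a ^ 2 + b ^ 2 = 1) : Real.cos (atan2 b a) = a := by
  have hn : ‖(⟨a, b⟩ : ℂ)‖ = 1 := by
    rw [Complex.norm_def, Complex.normSq_apply, ← sq, ← sq, h, Real.sqrt_one]
  rw [atan2, Complex.cos_arg (by rw [← norm_pos_iff, hn]; exact one_pos), hn, div_one]

theorem sin_atan2 {a b : ℝ} (h : a ^ 2 + b ^ 2 = 1) : Real.sin (atan2 b a) = b := by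
  have hn : ‖(⟨a, b⟩ : ℂ)‖ = 1 := by
    rw [Complex.norm_def, Complex.normSq_apply, ← sq, ← sq, h, Real.sqrt_one]
  rw [atan2, Complex.sin_arg, hn, div_one]

theorem arg_mem_headings (z : ℂ) : Complex.arg z ∈ headings :=
  ⟨(Complex.neg_pi_lt_arg z).le, Complex.arg_le_pi z⟩

/-- Factoring |x_I − x_D| out of ‖`zeta`‖ leaves the root in `Lam`. Here the sign and the special
case x_I = x_D have disappeared. -/
theorem Lam_eq {α : ℝ} (hα : 1 < α) {x : State} :
    Lam α x = (x 0 - x 2) / ‖zeta α x‖ := by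
  have h0 : 0 < α := by linarith
  rcases eq_or_ne (x 0 - x 2) 0 with hd | hd
  · simp [Lam, hd]
  · have hn : ‖zeta α x‖ = |x 0 - x 2| *
        Real.sqrt (α ^ 2 + (α ^ 2 - 1) ^ 2 / α ^ 2 * (x 3 ^ 2 / (x 0 - x 2) ^ 2)) := by
      rw [← Real.sqrt_sq_eq_abs, ← Real.sqrt_mul (sq_nonneg _), Complex.norm_def,
        Complex.normSq_apply]
      congr 1
      simp only [zeta]
      field_simp
    rw [Lam, hn, div_mul_eq_div_div]
    congr 1
    rcases lt_or_gt_of_ne hd with h | h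
    · rw [Real.sign_of_neg h, abs_of_neg h]; field_simp
    · rw [Real.sign_of_pos h, abs_of_pos h]; field_simp

theorem abs_Lam_le {α : ℝ} (hα : 1 < α) (x : State) : α * |Lam α x| ≤ 1 := by
  have h0 : 0 < α := by linarith
  have h := Complex.abs_re_le_norm (zeta α x)
  simp only [zeta, abs_mul, abs_of_pos h0] at h
  rw [Lam_eq hα, abs_div, abs_norm, ← mul_div_assoc]
  exact div_le_one_of_le₀ h (norm_nonneg _)

theorem cos_phiStar {α : ℝ} (hα : 1 < α) (x : State) : Real.cos (phiStar α x) = Lam α x := by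
  have h := abs_Lam_le hα x
  have : |Lam α x| ≤ 1 := by nlinarith [abs_nonneg (Lam α x)]
  have h2 : Lam α x ^ 2 ≤ 1 := by rw [← sq_abs]; nlinarith [abs_nonneg (Lam α x)]
  exact cos_atan2 (by rw [Real.sq_sqrt (by linarith)]; ring)

theorem sin_phiStar {α : ℝ} (hα : 1 < α) (x : State) :
    Real.sin (phiStar α x) = Real.sqrt (1 - Lam α x ^ 2) := by
  have h := abs_Lam_le hα x
  have : |Lam α x| ≤ 1 := by nlinarith [abs_nonneg (Lam α x)]
  have h2 : Lam α x ^ 2 ≤ 1 := by rw [← sq_abs]; nlinarith [abs_nonneg (Lam α x)]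
  exact sin_atan2 (by rw [Real.sq_sqrt (by linarith)]; ring)

theorem sqrt_one_sub_Lam_sq {α : ℝ} (hα : 1 < α) {x : State} (hx : 0 < spread α x) :
    Real.sqrt (1 - Lam α x ^ 2) = (α ^ 2 - 1) * spread α x / ‖zeta α x‖ := by
  have hb := sq_sub_one_pos hα
  have hN := norm_zeta_pos hα hx
  rw [Real.sqrt_eq_iff_mul_self_eq_of_pos (by positivity), Lam_eq hα]
  field_simp
  linarith [sq_norm_zeta hα x]

/-- The two arguments of `atan2` are the components of `zeta`/‖`zeta`‖. At y_D = 0 the root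
vanishes, so the value of the sign there does not matter. -/
theorem psiStar_eq {α : ℝ} (hα : 1 < α) {x : State} (hx : 0 < spread α x) :
    psiStar α x = Complex.arg (zeta α x) := by
  have hb := sq_sub_one_pos hα
  have h0 : 0 < α := by linarith
  have hN := norm_zeta_pos hα hx
  have hsq : ‖zeta α x‖ ^ 2 = (α * (x 0 - x 2)) ^ 2 + ((α ^ 2 - 1) / α * x 3) ^ 2 := by
    rw [Complex.sq_norm, Complex.normSq_apply]
    simp only [zeta]
    ring
  have hs : Real.sign (x 3) * Real.sqrt (1 - α ^ 2 * Lam α x ^ 2) =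
      (α ^ 2 - 1) / α * x 3 / ‖zeta α x‖ := by
    have : 1 - α ^ 2 * Lam α x ^ 2 = ((α ^ 2 - 1) / α * x 3 / ‖zeta α x‖) ^ 2 := by
      rw [Lam_eq hα, div_pow, div_pow _ ‖zeta α x‖, eq_div_iff (by positivity), sub_mul,
        ← mul_div_assoc, div_mul_cancel₀ _ (by positivity), hsq]
      ring
    rw [this, Real.sqrt_sq_eq_abs, abs_div, abs_mul, abs_norm, abs_of_pos (div_pos hb h0)]
    rcases lt_trichotomy (x 3) 0 with h | h | h
    · rw [Real.sign_of_neg h, abs_of_neg h]; ring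
    · simp [h]
    · rw [Real.sign_of_pos h, abs_of_pos h]; ring
  have hz : (⟨α * Lam α x, -(Real.sign (x 3) * Real.sqrt (1 - α ^ 2 * Lam α x ^ 2))⟩ : ℂ) =
      ((‖zeta α x‖⁻¹ : ℝ) : ℂ) * zeta α x := by
    rw [hs, Lam_eq hα]
    apply Complex.ext
    · rw [Complex.re_ofReal_mul]; simp only [zeta]; ring
    · rw [Complex.im_ofReal_mul]; simp only [zeta]; ring
  rw [psiStar, atan2, hz, Complex.arg_real_mul _ (inv_pos.2 hN)]

/-! ### Derivatives of the value function -/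

theorem contDiffAt_spread {α : ℝ} {x : State} (hx : 0 < spread α x) :
    ContDiffAt ℝ 1 (spread α) x := by
  unfold spread
  refine ContDiffAt.sqrt ?_ (Real.sqrt_pos.1 hx).ne'
  fun_prop

theorem contDiffAt_VI {α : ℝ} (l : ℝ) {x : State} (hx : 0 < spread α x) :
    ContDiffAt ℝ 1 (VI α l) x := by
  have h := contDiffAt_spread hx
  change ContDiffAt ℝ 1 (fun y => l - 1 / 2 * (y 1 + spread α y)) x
  fun_prop

/-- The gain of the Intruder. -/
def intruderRate (α : ℝ) (x : State) (φ : ℝ) : ℝ :=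
  (spread α x * Real.sin φ + (x 0 - x 2) * Real.cos φ / (α ^ 2 - 1))

/-- The gain of the Defender. -/
def defenderRate (α : ℝ) (x : State) (ψ : ℝ) : ℝ :=
  ((zeta α x).re * Real.cos ψ + (zeta α x).im * Real.sin ψ) / (α ^ 2 - 1)

theorem fderiv_VI {α : ℝ} (hα : 1 < α) (l : ℝ) {x : State} (hx : 0 < spread α x) (φ ψ : ℝ) :
    fderiv ℝ (VI α l) x (field α φ ψ) =
      (defenderRate α x ψ - intruderRate α x φ) / (2 * spread α x) := by
  have hb := sq_sub_one_pos hα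
  have h0 : 0 < α := by linarith
  have hd : DifferentiableAt ℝ (VI α l) x := (contDiffAt_VI l hx).differentiableAt one_ne_zero
  set e := field α φ ψ with he
  -- The derivative is computed along the line through `x` with direction `e`, where only
  -- one-variable rules are needed.
  have hline : HasDerivAt (fun t : ℝ => x + t • e) e 0 := by
    simpa using ((hasDerivAt_id (0 : ℝ)).smul_const e).const_add x
  have h1 : HasDerivAt (fun t : ℝ => VI α l (x + t • e)) (fderiv ℝ (VI α l) x e) 0 := by
    have hd' : HasFDerivAt (VI α l) (fderiv ℝ (VI α l) x) (x + (0 : ℝ) • e) := by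
      simpa using hd.hasFDerivAt
    exact hd'.comp_hasDerivAt 0 hline
  have hc : ∀ i, HasDerivAt (fun t : ℝ => (x + t • e) i) (e i) 0 := fun i =>
    (hasDerivAt_pi.1 hline) i
  have hS : HasDerivAt (fun t : ℝ => spread α (x + t • e))
      ((2 * (x 0 - x 2) * (e 0 - e 2) / (α ^ 2 - 1) + 2 * x 3 * e 3 / α ^ 2) /
        (2 * spread α x)) 0 := by
    have := (((((hc 0).sub (hc 2)).pow 2).div_const (α ^ 2 - 1)).add
      (((hc 3).pow 2).div_const (α ^ 2))).sqrt (by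
        have := (Real.sqrt_pos.1 hx).ne'
        simpa using this)
    convert! this using 1
    simp [spread]
  have h2 : HasDerivAt (fun t : ℝ => VI α l (x + t • e)) _ 0 :=
    (((hc 1).add hS).const_mul (1 / 2)).const_sub l
  rw [h1.unique h2, intruderRate, defenderRate]
  simp only [he, field, zeta]
  simp
  field_simp
  ring

theorem intruderRate_le {α : ℝ} (hα : 1 < α) (x : State) (φ : ℝ) :
    intruderRate α x φ ≤ ‖zeta α x‖ / (α ^ 2 - 1) := by
  have hb := sq_sub_one_pos hα
  rw [intruderRate, le_div_iff₀ hb, add_mul, div_mul_cancel₀ _ hb.ne']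
  refine abs_le_of_sq_le_sq' ?_ (norm_nonneg _) |>.2
  rw [sq_norm_zeta hα]
  have h1 := Real.sin_sq_add_cos_sq φ
  -- Cauchy–Schwarz: the square in the hint is the defect in Lagrange's identity.
  nlinarith [sq_nonneg ((α ^ 2 - 1) * spread α x * Real.cos φ - (x 0 - x 2) * Real.sin φ),
    congrArg (· * ((α ^ 2 - 1) ^ 2 * spread α x ^ 2 + (x 0 - x 2) ^ 2)) h1]

theorem intruderRate_phiStar {α : ℝ} (hα : 1 < α) {x : State} (hx : 0 < spread α x) :
    intruderRate α x (phiStar α x) = ‖zeta α x‖ / (α ^ 2 - 1) := by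
  have hb := sq_sub_one_pos hα
  have hN := norm_zeta_pos hα hx
  rw [intruderRate, sin_phiStar hα, cos_phiStar hα, sqrt_one_sub_Lam_sq hα hx, Lam_eq hα]
  field_simp
  linarith [sq_norm_zeta hα x]

theorem defenderRate_le {α : ℝ} (hα : 1 < α) (x : State) (ψ : ℝ) :
    defenderRate α x ψ ≤ ‖zeta α x‖ / (α ^ 2 - 1) := by
  have hb := sq_sub_one_pos hα
  rw [defenderRate]
  refine div_le_div_of_nonneg_right ?_ hb.le
  refine abs_le_of_sq_le_sq' ?_ (norm_nonneg _) |>.2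
  rw [Complex.sq_norm, Complex.normSq_apply]
  have h1 := Real.sin_sq_add_cos_sq ψ
  nlinarith [sq_nonneg ((zeta α x).re * Real.sin ψ - (zeta α x).im * Real.cos ψ),
    congrArg (· * ((zeta α x).re ^ 2 + (zeta α x).im ^ 2)) h1]

theorem defenderRate_psiStar {α : ℝ} (hα : 1 < α) {x : State} (hx : 0 < spread α x) :
    defenderRate α x (psiStar α x) = ‖zeta α x‖ / (α ^ 2 - 1) := by
  have hN := norm_zeta_pos hα hx
  rw [defenderRate, psiStar_eq hα hx, Complex.cos_arg (norm_pos_iff.1 hN), Complex.sin_arg]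
  congr 1
  field_simp
  rw [Complex.sq_norm, Complex.normSq_apply]
  ring

/-- The controls enter through separate terms, so the minimum and the maximum are taken
independently and their contributions cancel. -/
theorem hji {α : ℝ} (hα : 1 < α) (l : ℝ) {x : State} (hx : 0 < spread α x) :
    HJI α (VI α l) x := by
  have hpos : 0 < 2 * spread α x := by positivity
  constructor
  · refine ⟨phiStar α x, arg_mem_headings _, ⟨psiStar α x, arg_mem_headings _, ?_⟩, ?_⟩
    · simp only [fderiv_VI hα l hx, intruderRate_phiStar hα hx, defenderRate_psiStar hα hx, sub_self,
        zero_div]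
    · rintro _ ⟨ψ, -, rfl⟩
      simp only [fderiv_VI hα l hx, intruderRate_phiStar hα hx]
      exact div_nonpos_of_nonpos_of_nonneg (sub_nonpos.2 (defenderRate_le hα x ψ)) hpos.le
  · rintro m ⟨φ, -, hm⟩
    refine le_trans ?_ (hm.2 ⟨psiStar α x, arg_mem_headings _, rfl⟩)
    simp only [fderiv_VI hα l hx, defenderRate_psiStar hα hx]
    exact div_nonneg (sub_nonneg.2 (intruderRate_le hα x φ)) hpos.le

/-! ### Trajectories under measurable controls and monotonicity of `VI` along them. -/

theorem abs_field_le {α : ℝ} (hα : 1 < α) (φ ψ : ℝ) (i : Fin 4) : |field α φ ψ i| ≤ α := by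
  have h1 := Real.abs_cos_le_one φ
  have h2 := Real.abs_sin_le_one φ
  have h3 := Real.abs_cos_le_one ψ
  have h4 := Real.abs_sin_le_one ψ
  have h0 : 0 < α := by linarith
  fin_cases i
  · simp [field]; linarith
  · simp [field]; linarith
  · simp only [field, abs_mul, abs_of_pos h0, Fin.reduceFinMk, Matrix.cons_val]; nlinarith
  · simp only [field, abs_mul, abs_of_pos h0, Fin.reduceFinMk, Matrix.cons_val]; nlinarith

theorem measurable_field {α : ℝ} {u v : ℝ → ℝ} (hu : Measurable u) (hv : Measurable v)
    (i : Fin 4) : Measurable fun s => field α (u s) (v s) i := by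
  fin_cases i <;> simp only [field, Fin.reduceFinMk, Matrix.cons_val, Fin.zero_eta, Fin.mk_one,
    Matrix.cons_val_zero, Matrix.cons_val_one] <;> fun_prop

theorem intervalIntegrable_field {α : ℝ} (hα : 1 < α) {u v : ℝ → ℝ} (hu : Measurable u)
    (hv : Measurable v) (i : Fin 4) (a b : ℝ) :
    IntervalIntegrable (fun s => field α (u s) (v s) i) volume a b := by
  refine (intervalIntegrable_const (c := α)).mono_fun
    (measurable_field hu hv i).aestronglyMeasurable ?_
  refine Filter.Eventually.of_forall fun s => ?_
  exact (abs_field_le hα _ _ _).trans (le_abs_self α)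

/-- The trajectory generated by a pair of controls. -/
def trajOf (α : ℝ) (x0 : State) (u v : ℝ → ℝ) (t : ℝ) : State :=
  fun i => x0 i + ∫ s in (0 : ℝ)..t, field α (u s) (v s) i

/-- The play generated by a pair of controls and a switching time. -/
def playOf (α : ℝ) (x0 : State) (u v : ℝ → ℝ) (ts : WithTop ℝ) (hu : Measurable u)
    (hv : Measurable v) (hu' : ∀ t, u t ∈ headings) (hv' : ∀ t, v t ∈ headings) (hts : 0 ≤ ts) :
    Play α x0 where
  u := u
  v := v
  traj := trajOf α x0 u v
  ts := ts
  measurable_u := hu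
  measurable_v := hv
  u_mem := hu'
  v_mem := hv'
  traj_eq := fun _ _ _ => rfl
  ts_nonneg := hts

namespace Play

variable {α : ℝ} {x0 : State}

theorem traj_zero (p : Play α x0) : p.traj 0 = x0 := by
  ext i
  simp [p.traj_eq 0 le_rfl i]

theorem abs_traj_sub_le (hα : 1 < α) (p : Play α x0) {s t : ℝ} (hs : 0 ≤ s) (ht : 0 ≤ t)
    (i : Fin 4) : |p.traj t i - p.traj s i| ≤ α * |t - s| := by
  have hi := intervalIntegrable_field hα p.measurable_u p.measurable_v i
  rw [p.traj_eq t ht, p.traj_eq s hs, add_sub_add_left_eq_sub,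
    intervalIntegral.integral_interval_sub_left (hi 0 t) (hi 0 s)]
  exact intervalIntegral.norm_integral_le_of_norm_le_const
    (f := fun r => field α (p.u r) (p.v r) i) fun r _ => abs_field_le hα _ _ _

theorem continuousOn_traj (hα : 1 < α) (p : Play α x0) : ContinuousOn p.traj (Ici 0) := by
  refine continuousOn_pi.2 fun i => ?_
  have : LipschitzOnWith α.toNNReal (fun t => p.traj t i) (Ici 0) := by
    refine LipschitzOnWith.of_dist_le_mul fun t ht s hs => ?_
    rw [Real.coe_toNNReal _ (by linarith), Real.dist_eq, Real.dist_eq]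
    exact p.abs_traj_sub_le hα hs ht i
  exact this.continuousOn

theorem ae_hasDerivAt_traj (hα : 1 < α) (p : Play α x0) :
    ∀ᵐ t : ℝ, 0 < t → HasDerivAt p.traj (field α (p.u t) (p.v t)) t := by
  have h : ∀ i : Fin 4, ∀ᵐ t : ℝ, ∀ c, HasDerivAt
      (fun t => ∫ s in c..t, field α (p.u s) (p.v s) i) (field α (p.u t) (p.v t) i) t := fun i => by
    refine LocallyIntegrable.ae_hasDerivAt_integral ?_
    refine (locallyIntegrable_const α).mono
      (measurable_field p.measurable_u p.measurable_v i).aestronglyMeasurable ?_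
    exact Filter.Eventually.of_forall fun s => (abs_field_le hα _ _ _).trans (le_abs_self α)
  filter_upwards [ae_all_iff.2 h] with t ht ht0
  refine hasDerivAt_pi.2 fun i => ?_
  refine ((ht i 0).const_add (x0 i)).congr_of_eventuallyEq ?_
  filter_upwards [lt_mem_nhds ht0] with s hs
  exact p.traj_eq s hs.le i

theorem exists_lipschitzOnWith_VI (hα : 1 < α) (l : ℝ) (p : Play α x0) :
    ∃ K, LipschitzOnWith K (fun t => VI α l (p.traj t)) (Ici 0) := by
  have hb := sq_sub_one_pos hα
  have h0 : 0 < α := by linarith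
  refine ⟨(1 / 2 * (α + ((α + α) / Real.sqrt (α ^ 2 - 1) + α / α))).toNNReal,
    LipschitzOnWith.of_dist_le_mul fun t ht s hs => ?_⟩
  have h := fun i => p.abs_traj_sub_le hα hs ht i
  rw [Real.coe_toNNReal _ (by positivity), Real.dist_eq, Real.dist_eq, VI_eq, VI_eq]
  have hS : |spread α (p.traj t) - spread α (p.traj s)| ≤
      (α * |t - s| + α * |t - s|) / Real.sqrt (α ^ 2 - 1) + α * |t - s| / α := by
    refine (abs_spread_sub_le hα _ _).trans ?_
    gcongr <;> exact h _
  calc _ = |1 / 2 * ((p.traj t 1 - p.traj s 1) + (spread α (p.traj t) - spread α (p.traj s)))| := by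
        rw [← abs_neg]; congr 1; ring
    _ ≤ 1 / 2 * (α * |t - s| +
        ((α * |t - s| + α * |t - s|) / Real.sqrt (α ^ 2 - 1) + α * |t - s| / α)) := by
        rw [abs_mul, abs_of_pos (by norm_num : (0 : ℝ) < 1 / 2)]
        gcongr
        exact (abs_add_le _ _).trans (add_le_add (h 1) hS)
    _ = _ := by ring

theorem ae_hasDerivAt_VI (hα : 1 < α) (l : ℝ) (p : Play α x0) :
    ∀ᵐ t : ℝ, 0 < t → 0 < spread α (p.traj t) → HasDerivAt (fun t => VI α l (p.traj t))
      ((defenderRate α (p.traj t) (p.v t) - intruderRate α (p.traj t) (p.u t)) /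
        (2 * spread α (p.traj t))) t := by
  filter_upwards [p.ae_hasDerivAt_traj hα] with t ht h0 hS
  rw [← fderiv_VI hα l hS]
  exact ((contDiffAt_VI l hS).differentiableAt one_ne_zero).hasFDerivAt.comp_hasDerivAt t (ht h0)

/-- The Isaacs inequality, integrated. Positivity of `spread` is asked only at interior times; the
Lipschitz bound takes care of the endpoints. -/
theorem VI_traj_le (hα : 1 < α) (l : ℝ) (p : Play α x0) {T : ℝ} (hT : 0 ≤ T)
    (hS : ∀ t ∈ Ioo 0 T, 0 < spread α (p.traj t))
    (hu : ∀ᵐ t : ℝ, t ∈ Ioo 0 T → p.u t = phiStar α (p.traj t)) :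
    VI α l (p.traj T) ≤ VI α l x0 := by
  obtain ⟨K, hK⟩ := p.exists_lipschitzOnWith_VI hα l
  have h := le_of_lipschitzOnWith_of_ae_deriv_nonpos hT (hK.mono Icc_subset_Ici_self) ?_
  · rwa [p.traj_zero] at h
  filter_upwards [p.ae_hasDerivAt_VI hα l, hu] with t ht hut htT
  refine ⟨_, ?_, ht htT.1 (hS t htT)⟩
  rw [hut htT, intruderRate_phiStar hα (hS t htT)]
  exact div_nonpos_of_nonpos_of_nonneg (sub_nonpos.2 (defenderRate_le hα _ _))
    (by linarith [hS t htT])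

theorem le_VI_traj (hα : 1 < α) (l : ℝ) (p : Play α x0) {T : ℝ} (hT : 0 ≤ T)
    (hS : ∀ t ∈ Ioo 0 T, 0 < spread α (p.traj t))
    (hv : ∀ᵐ t : ℝ, t ∈ Ioo 0 T → p.v t = psiStar α (p.traj t)) :
    VI α l x0 ≤ VI α l (p.traj T) := by
  obtain ⟨K, hK⟩ := p.exists_lipschitzOnWith_VI hα l
  have h := le_of_lipschitzOnWith_of_ae_deriv_nonpos hT
    ((hK.mono Icc_subset_Ici_self).neg) ?_
  · simp only [Pi.neg_apply, neg_le_neg_iff] at h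
    rwa [p.traj_zero] at h
  filter_upwards [p.ae_hasDerivAt_VI hα l, hv] with t ht hvt htT
  refine ⟨_, ?_, (ht htT.1 (hS t htT)).neg⟩
  rw [hvt htT, defenderRate_psiStar hα (hS t htT), neg_nonpos]
  exact div_nonneg (sub_nonneg.2 (intruderRate_le hα _ _)) (by linarith [hS t htT])

theorem active_of_forall_lt (hα : 1 < α) (p : Play α x0) {t : ℝ} (ht : (t : WithTop ℝ) < p.ts)
    (h : ∀ s ∈ Icc 0 t, 0 < p.traj s 1 ∧ p.traj s 1 ≤ spread α (p.traj s)) : p.Active t :=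
  ⟨ht, fun s hs => ⟨(mem_XII_iff hα (h s hs).1).2 (h s hs).2, (h s hs).1⟩⟩

theorem le_payoff_of_defenderFollows (hα : 1 < α) {l : ℝ} (p : Play α x0)
    (hp : p.DefenderFollows (psiStar α)) : ((VI α l x0 : ℝ) : EReal) ≤ p.payoff l := by
  classical
  rw [payoff]
  split_ifs with hsafe
  swap
  · exact le_top
  obtain ⟨htop, hX, hpos⟩ := hsafe
  lift p.ts to ℝ using htop with T hTs
  have hT : 0 ≤ T := by have := p.ts_nonneg; rw [← hTs] at this; exact_mod_cast this
  have hact : ∀ t ∈ Ioo 0 T, p.Active t := fun t ht =>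
    ⟨by rw [← hTs]; exact_mod_cast ht.2, fun s hs =>
      ⟨hX s hs.1 (by exact_mod_cast hs.2.trans ht.2.le),
        hpos s hs.1 (by exact_mod_cast hs.2.trans_lt ht.2)⟩⟩
  have hS : ∀ t ∈ Ioo 0 T, 0 < spread α (p.traj t) := fun t ht => by
    obtain ⟨h1, h2⟩ := (hact t ht).2 t ⟨ht.1.le, le_rfl⟩
    exact h2.trans_le (le_spread_of_mem_XII hα h1)
  have h := p.le_VI_traj hα l hT hS (by
    filter_upwards [hp] with t ht htT
    exact ht htT.1.le (hact t htT))
  -- Safety at the switching time gives y_I ≤ `spread`, hence `VI` ≤ l − y_I there.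
  have h2 := le_spread_of_mem_XII hα (hX T hT le_rfl)
  rw [VI_eq _ _ (p.traj T)] at h
  simp only [WithTop.untopD_coe]
  exact EReal.coe_le_coe_iff.2 (by linarith)

end Play

/-! ### The Intruder's guarantee: safety, termination, payoff. -/

/-- A lower bound for the vertical speed of the Intruder when it uses its equilibrium heading. -/
theorem sin_phiStar_ge {α : ℝ} (hα : 1 < α) (x : State) :
    Real.sqrt (1 - (1 / α) ^ 2) ≤ Real.sin (phiStar α x) := by
  rw [sin_phiStar hα]
  have h0 : 0 < α := by linarith
  refine Real.sqrt_le_sqrt (sub_le_sub_left ?_ 1)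
  refine sq_le_sq.2 ?_
  rw [abs_of_pos (one_div_pos.2 h0), le_div_iff₀ h0, mul_comm]
  exact abs_Lam_le hα x

theorem sqrt_one_sub_inv_sq_pos {α : ℝ} (hα : 1 < α) : 0 < Real.sqrt (1 - (1 / α) ^ 2) := by
  refine Real.sqrt_pos.2 (sub_pos.2 ?_)
  rw [sq_lt_one_iff₀ (by positivity), div_lt_one (by positivity)]
  exact hα

namespace Play

variable {α : ℝ} {x0 : State}

theorem le_traj_one (hα : 1 < α) (p : Play α x0) {c T : ℝ} (hT : 0 ≤ T)
    (hu : ∀ᵐ t : ℝ, t ∈ Ioo 0 T → c ≤ Real.sin (p.u t)) :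
    x0 1 + c * T ≤ p.traj T 1 := by
  rw [p.traj_eq T hT 1]
  have hi := intervalIntegrable_field hα p.measurable_u p.measurable_v 1 0 T
  have : ∫ s in (0 : ℝ)..T, c ≤ ∫ s in (0 : ℝ)..T, field α (p.u s) (p.v s) 1 := by
    refine intervalIntegral.integral_mono_ae_restrict hT (by simp) hi ?_
    rw [Filter.EventuallyLE, ae_restrict_iff' measurableSet_Icc]
    filter_upwards [hu, Measure.ae_ne volume (0 : ℝ), Measure.ae_ne volume T] with t h h0 hT' ht
    simpa [field] using h ⟨lt_of_le_of_ne ht.1 (Ne.symm h0), lt_of_le_of_ne ht.2 hT'⟩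
  simp at this
  linarith

theorem traj_one_le_spread (hα : 1 < α) (p : Play α x0) (h0 : x0 1 ≤ spread α x0) {T : ℝ}
    (hT : 0 ≤ T) (h : ∀ s, 0 ≤ s → s < T → p.traj s 1 ≤ spread α (p.traj s)) :
    p.traj T 1 ≤ spread α (p.traj T) := by
  rcases hT.eq_or_lt with hT0 | hT0
  · rwa [← hT0, p.traj_zero]
  · have hcl : closure (Ico 0 T) = Icc 0 T := closure_Ico hT0.ne
    have hcont : ContinuousOn p.traj (Icc 0 T) := (p.continuousOn_traj hα).mono Icc_subset_Ici_self
    exact le_on_closure (s := Ico 0 T) (fun s hs => h s hs.1 hs.2)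
      (by rw [hcl]; exact (continuousOn_pi.1 hcont) 1)
      (by rw [hcl]; exact (continuous_spread α).comp_continuousOn hcont)
      (by rw [hcl]; exact ⟨hT, le_rfl⟩)

/-- While the Intruder has not switched, it stays strictly inside the safe region. -/
theorem safe_of_intruderFollows (hα : 1 < α) {l : ℝ} (p : Play α x0)
    (hx : x0 ∈ XII α) (h1 : 0 < x0 1) (hp : p.IntruderFollows (sigmaStar α l)) :
    ∀ t : ℝ, 0 ≤ t → (t : WithTop ℝ) < p.ts →
      0 < p.traj t 1 ∧ p.traj t 1 < spread α (p.traj t) := by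
  obtain ⟨hu, -, hns⟩ := hp
  intro T hT hTs
  have hc := sqrt_one_sub_inv_sq_pos hα
  have hcont : ContinuousOn p.traj (Icc 0 T) := (p.continuousOn_traj hα).mono Icc_subset_Ici_self
  have hcont1 : ContinuousOn (fun t => p.traj t 1) (Icc 0 T) := (continuousOn_pi.1 hcont) 1
  have hcontS : ContinuousOn (fun t => spread α (p.traj t)) (Icc 0 T) :=
    (continuous_spread α).comp_continuousOn hcont
  suffices H : ∀ t ∈ Icc 0 T,
      0 < min (p.traj t 1) (spread α (p.traj t) - p.traj t 1) by
    simpa using H T ⟨hT, le_rfl⟩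
  -- The feedback is prescribed only while the play is active, which itself presupposes safety; the
  -- first-exit argument breaks this circle. At a first exit y_I is still positive since it has
  -- grown, and y_I = `spread` would be a switching state.
  refine pos_of_forall_first_exit 
    (continuous_min.comp_continuousOn (hcont1.prodMk (hcontS.sub hcont1))) fun t ⟨ht0, htT⟩ hgood => ?_
  replace hgood : ∀ s, 0 ≤ s → s < t → 0 < p.traj s 1 ∧ p.traj s 1 < spread α (p.traj s) :=
    fun s hs0 hst => by simpa using hgood s ⟨hs0, hst⟩
  have hlt : (t : WithTop ℝ) < p.ts := lt_of_le_of_lt (by exact_mod_cast htT) hTs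
  have h1t : 0 < p.traj t 1 := by
    have := p.le_traj_one hα ht0 (c := Real.sqrt (1 - (1 / α) ^ 2)) (by
      filter_upwards [hu] with s hs hst
      rw [hs hst.1.le (p.active_of_forall_lt hα (lt_trans (by exact_mod_cast hst.2) hlt)
        fun r hr => ⟨(hgood r hr.1 (hr.2.trans_lt hst.2)).1,
          (hgood r hr.1 (hr.2.trans_lt hst.2)).2.le⟩)]
      exact sin_phiStar_ge hα _)
    nlinarith [mul_nonneg hc.le ht0]
  have hle := p.traj_one_le_spread hα (le_spread_of_mem_XII hα hx) ht0
    fun s hs0 hst => (hgood s hs0 hst).2.le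
  refine lt_min h1t (sub_pos.2 (lt_of_le_of_ne hle fun heq => ?_))
  exact hns t ht0 hlt (Or.inl ((VII_eq_zero_iff hα h1t).2 heq))

theorem payoff_le_of_intruderFollows (hα : 1 < α) {l : ℝ} (p : Play α x0)
    (hx : x0 ∈ XI α l) (h1 : 0 < x0 1) (hp : p.IntruderFollows (sigmaStar α l)) :
    p.payoff l ≤ ((VI α l x0 : ℝ) : EReal) := by
  have hsafe := p.safe_of_intruderFollows hα hx.1 h1 hp
  obtain ⟨hu, hsw, hns⟩ := hp
  have hc := sqrt_one_sub_inv_sq_pos hα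
  have hact : ∀ t : ℝ, 0 ≤ t → (t : WithTop ℝ) < p.ts → p.Active t := fun t ht0 ht =>
    p.active_of_forall_lt hα ht fun s hs =>
      have h := hsafe s hs.1 (lt_of_le_of_lt (by exact_mod_cast hs.2) ht)
      ⟨h.1, h.2.le⟩
  have hgrow : ∀ T : ℝ, 0 ≤ T → (T : WithTop ℝ) ≤ p.ts →
      x0 1 + Real.sqrt (1 - (1 / α) ^ 2) * T ≤ p.traj T 1 := fun T hT hTs =>
    p.le_traj_one hα hT (by
      filter_upwards [hu] with s hs hsT
      rw [hs hsT.1.le (hact s hsT.1.le (lt_of_lt_of_le (by exact_mod_cast hsT.2) hTs))]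
      exact sin_phiStar_ge hα _)
  have htop : p.ts ≠ ⊤ := by
    intro htop
    -- Climbing at least at the minimal vertical speed, the Intruder reaches height l by this time.
    set T := |l| / Real.sqrt (1 - (1 / α) ^ 2)
    have hT : 0 ≤ T := by positivity
    have h := hgrow T hT (by simp [htop])
    rw [mul_div_cancel₀ _ hc.ne'] at h
    exact hns T hT (by simp [htop]) (Or.inr (by linarith [le_abs_self l]))
  obtain ⟨T, hTs⟩ := WithTop.ne_top_iff_exists.1 htop
  have hT : 0 ≤ T := by have := p.ts_nonneg; rw [← hTs] at this; exact_mod_cast this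
  have hgood : ∀ s, 0 ≤ s → s < T → 0 < p.traj s 1 ∧ p.traj s 1 < spread α (p.traj s) :=
    fun s hs0 hsT => hsafe s hs0 (by rw [← hTs]; exact_mod_cast hsT)
  have h1T : 0 < p.traj T 1 := by
    have := hgrow T hT hTs.le
    nlinarith [mul_nonneg hc.le hT]
  have hleT := p.traj_one_le_spread hα (le_spread_of_mem_XII hα hx.1) hT
    fun s hs0 hsT => (hgood s hs0 hsT).2.le
  have hswitch : p.SwitchesSafely := by
    refine ⟨htop, fun s hs0 hs => ?_, fun s hs0 hs => (hsafe s hs0 hs).1⟩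
    rcases hs.lt_or_eq with h | h
    · exact (mem_XII_iff hα (hsafe s hs0 h).1).2 (hsafe s hs0 h).2.le
    · rw [← hTs] at h
      obtain rfl : s = T := by exact_mod_cast h
      exact (mem_XII_iff hα h1T).2 hleT
  have h := p.VI_traj_le hα l hT (fun t ht => (hgood t ht.1.le ht.2).1.trans
    (hgood t ht.1.le ht.2).2) (by
      filter_upwards [hu] with s hs hsT
      exact hs hsT.1.le (hact s hsT.1.le (by rw [← hTs]; exact_mod_cast hsT.2)))
  rw [payoff, if_pos hswitch, ← hTs, WithTop.untopD_coe]
  refine EReal.coe_le_coe_iff.2 ?_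
  -- On the critical surface the payoff equals `VI`, which has not increased; at height l or above
  -- it is at most 0 ≤ `VI α l x0`.
  rcases hsw T hTs.symm with h0 | h0
  · rw [VII_eq_zero_iff hα h1T] at h0
    rw [VI_eq _ _ (p.traj T)] at h
    linarith
  · linarith [hx.2]

end Play

/-! ### Existence of plays that follow the feedbacks. -/

/-- The vector `zeta` as a function of the horizontal distance of the players and the height of the
Defender. -/
def zetaVec (α z w : ℝ) : ℂ := ⟨α * z, -((α ^ 2 - 1) / α * w)⟩

theorem zeta_eq_zetaVec (α : ℝ) (x : State) : zeta α x = zetaVec α (x 0 - x 2) (x 3) := rfl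

theorem continuous_complex_mk {X : Type*} [TopologicalSpace X] {s : Set X} {a b : X → ℝ}
    (ha : ContinuousOn a s) (hb : ContinuousOn b s) :
    ContinuousOn (fun t => (⟨a t, b t⟩ : ℂ)) s :=
  Complex.equivRealProdCLM.symm.continuous.comp_continuousOn (ha.prodMk hb)

theorem measurable_complex_mk {a b : ℝ → ℝ} (ha : Measurable a) (hb : Measurable b) :
    Measurable fun t => (⟨a t, b t⟩ : ℂ) :=
  Complex.equivRealProdCLM.symm.continuous.measurable.comp (ha.prodMk hb)

theorem continuousOn_zetaVec {X : Type*} [TopologicalSpace X] {s : Set X} {a b : X → ℝ} (α : ℝ)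
    (ha : ContinuousOn a s) (hb : ContinuousOn b s) :
    ContinuousOn (fun t => zetaVec α (a t) (b t)) s :=
  continuous_complex_mk (continuousOn_const.mul ha) ((continuousOn_const.mul hb).neg)

theorem dist_zetaVec_le {α : ℝ} (hα : 1 < α) (a b a' b' : ℝ) :
    dist (zetaVec α a b) (zetaVec α a' b') ≤ α * |a - a'| + (α ^ 2 - 1) / α * |b - b'| := by
  have hb := sq_sub_one_pos hα
  have h0 : 0 < α := by linarith
  rw [dist_eq_norm]
  refine (Complex.norm_le_abs_re_add_abs_im _).trans (le_of_eq ?_)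
  simp only [zetaVec, Complex.sub_re, Complex.sub_im]
  rw [← mul_sub, abs_mul, abs_of_pos h0, neg_sub_neg, ← mul_sub, abs_mul,
    abs_of_pos (div_pos hb h0), abs_sub_comm b b']

theorem continuous_trajOf {α : ℝ} (hα : 1 < α) (x0 : State) {u v : ℝ → ℝ} (hu : Measurable u)
    (hv : Measurable v) (i : Fin 4) : Continuous fun t => trajOf α x0 u v t i :=
  continuous_const.add (intervalIntegral.continuous_primitive
    (fun a b => intervalIntegrable_field hα hu hv i a b) 0)

theorem isTimeInterval_Ici : IsTimeInterval (Ici 0) :=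
  ⟨fun _ h => h, fun _ _ _ h _ => h⟩

/-- A heading of the Intruder that agrees with `phiStar` along its own trajectory as long as the
spread stays above `ε / (α² - 1)`. -/
theorem exists_intruder_heading {α : ℝ} (hα : 1 < α) (x0 : State) {ε : ℝ} (hε : 0 < ε)
    {v : ℝ → ℝ} (hv : Measurable v) :
    ∃ u : ℝ → ℝ, Measurable u ∧ (∀ t, u t ∈ headings) ∧
      (∀ t, Real.sqrt (1 - (1 / α) ^ 2) ≤ Real.sin (u t)) ∧
      ∀ t, 0 ≤ t → ε ≤ ‖zeta α (trajOf α x0 u v t)‖ → u t = phiStar α (trajOf α x0 u v t) := by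
  have h0 : 0 < α := by linarith
  -- Only the Defender's coordinates of `Y` are used, and they do not depend on the Intruder's dummy
  -- heading. As `zeta` does not involve y_I, a scalar equation for x_I remains.
  set Y : ℝ → State := trajOf α x0 (fun _ => 0) v
  have hY : ∀ i, Continuous fun t => Y t i := continuous_trajOf hα x0 measurable_const hv
  have hret := lipschitzWith_inv_max_smul (E := ℂ) hε
  let f : ℝ → ℝ → ℝ := fun t x =>
    ((max ε ‖zetaVec α (x - Y t 2) (Y t 3)‖)⁻¹ • zetaVec α (x - Y t 2) (Y t 3)).re / α
  have hf : ∀ t x, |f t x| ≤ 1 / α := fun t x => by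
    rw [abs_div, abs_of_pos h0]
    exact div_le_div_of_nonneg_right ((Complex.abs_re_le_norm _).trans
      (norm_inv_max_smul_le _ _)) h0.le
  obtain ⟨q, hqc, hfc, hq⟩ := exists_integral_solution isTimeInterval_Ici (f := f) (M := 1)
    (fun t x => (hf t x).trans (by rw [div_le_iff₀ h0]; simpa using hα.le))
    (fun T _ => ⟨(2 / ε).toNNReal, fun t _ => LipschitzWith.of_dist_le_mul fun x y => by
      have h1 := hret.dist_le_mul (zetaVec α (x - Y t 2) (Y t 3)) (zetaVec α (y - Y t 2) (Y t 3))
      have h2 := dist_zetaVec_le hα (x - Y t 2) (Y t 3) (y - Y t 2) (Y t 3)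
      rw [sub_self, abs_zero, mul_zero, add_zero, sub_sub_sub_cancel_right] at h2
      rw [Real.dist_eq, Real.dist_eq, ← sub_div, ← Complex.sub_re, abs_div, abs_of_pos h0,
        div_le_iff₀ h0]
      refine (Complex.abs_re_le_norm _).trans ?_
      rw [← dist_eq_norm]
      refine h1.trans ?_
      rw [mul_assoc, mul_comm |x - y| α]
      gcongr⟩)
    (fun x => by
      refine ContinuousOn.div_const ?_ α
      refine Complex.continuous_re.comp_continuousOn (hret.continuous.comp_continuousOn ?_)
      exact continuousOn_zetaVec α (continuousOn_const.sub (hY 2).continuousOn) (hY 3).continuousOn)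
    (x0 0)
  classical
  let lam : ℝ → ℝ := (Ici 0).piecewise (fun t => f t (q t)) (fun _ => 0)
  have hlamm : Measurable lam := hfc.measurable_piecewise continuousOn_const measurableSet_Ici
  have hlam : ∀ t, |lam t| ≤ 1 / α := fun t => by
    by_cases ht : t ∈ Ici (0 : ℝ)
    · simp only [lam, piecewise_eq_of_mem _ _ _ ht]; exact hf _ _
    · simp only [lam, piecewise_eq_of_notMem _ _ _ ht, abs_zero]; positivity
  have hsq : ∀ t, lam t ^ 2 ≤ (1 / α) ^ 2 := fun t =>
    sq_le_sq.2 ((hlam t).trans (le_abs_self _))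
  have hinv : (1 / α) ^ 2 < 1 := by
    rw [sq_lt_one_iff₀ (by positivity), div_lt_one h0]; exact hα
  have hunit : ∀ t, lam t ^ 2 + Real.sqrt (1 - lam t ^ 2) ^ 2 = 1 := fun t => by
    rw [Real.sq_sqrt (by linarith [hsq t])]; ring
  let u : ℝ → ℝ := fun t => atan2 (Real.sqrt (1 - lam t ^ 2)) (lam t)
  have hum : Measurable u :=
    Complex.measurable_arg.comp (measurable_complex_mk hlamm (by fun_prop))
  have hcos : ∀ t, Real.cos (u t) = lam t := fun t => cos_atan2 (hunit t)
  have hsin : ∀ t, Real.sin (u t) = Real.sqrt (1 - lam t ^ 2) := fun t => sin_atan2 (hunit t)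
  refine ⟨u, hum, fun t => arg_mem_headings _, fun t => ?_, fun t ht hz => ?_⟩
  · rw [hsin]
    exact Real.sqrt_le_sqrt (sub_le_sub_left (hsq t) 1)
  have hxq : trajOf α x0 u v t 0 = q t := by
    rw [hq t ht]
    change x0 0 + ∫ s in (0 : ℝ)..t, Real.cos (u s) = _
    congr 1
    refine intervalIntegral.integral_congr fun s hs => ?_
    rw [uIcc_of_le ht] at hs
    simp only [hcos, lam, piecewise_eq_of_mem _ _ _ (show s ∈ Ici (0 : ℝ) from hs.1)]
  have hzz : zetaVec α (q t - Y t 2) (Y t 3) = zeta α (trajOf α x0 u v t) := by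
    rw [zeta_eq_zetaVec, hxq]; rfl
  have : lam t = Lam α (trajOf α x0 u v t) := by
    simp only [lam, piecewise_eq_of_mem _ _ _ (show t ∈ Ici (0 : ℝ) from ht), f]
    rw [hzz, max_eq_right hz, Complex.smul_re, Lam_eq hα, zeta]
    simp only [smul_eq_mul]
    field_simp
  simp only [u, phiStar, this]

theorem exists_play_intruderFollows {α l : ℝ} (hα : 1 < α) {x0 : State} (h1 : 0 < x0 1)
    {v : ℝ → ℝ} (hv : Measurable v) (hv' : ∀ t, v t ∈ headings) :
    ∃ p : Play α x0, p.v = v ∧ p.IntruderFollows (sigmaStar α l) := by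
  have hb := sq_sub_one_pos hα
  have hc := sqrt_one_sub_inv_sq_pos hα
  -- y_I never falls below its initial value, so ‖`zeta`‖ ≥ (α² − 1) `spread` ≥ (α² − 1) y_I stays
  -- above this threshold as long as the play is safe.
  obtain ⟨u, hu, hu', hsin, hfol⟩ := exists_intruder_heading hα x0 (mul_pos hb h1) hv
  have hgrow : ∀ t, 0 ≤ t → x0 1 + Real.sqrt (1 - (1 / α) ^ 2) * t ≤ trajOf α x0 u v t 1 :=
    fun t ht => (playOf α x0 u v ⊤ hu hv hu' hv' le_top).le_traj_one hα ht
      (Filter.Eventually.of_forall fun s _ => hsin s)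
  have hy : ∀ t, 0 ≤ t → x0 1 ≤ trajOf α x0 u v t 1 := fun t ht => by
    nlinarith [hgrow t ht, mul_nonneg hc.le ht]
  have hcont : Continuous (trajOf α x0 u v) := continuous_pi (continuous_trajOf hα x0 hu hv)
  have hcont1 := continuous_trajOf hα x0 hu hv 1
  set T := |l| / Real.sqrt (1 - (1 / α) ^ 2) with hTdef
  have hT : 0 ≤ T := by positivity
  -- The switching condition is rewritten with the continuous `spread`, so that the switching times
  -- up to `T` form a compact set with a first element.
  let C : Set ℝ := Icc 0 T ∩ ({t | trajOf α x0 u v t 1 = spread α (trajOf α x0 u v t)} ∪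
    {t | l ≤ trajOf α x0 u v t 1})
  have hC : IsCompact C := isCompact_Icc.inter_right
    ((isClosed_eq hcont1 ((continuous_spread α).comp hcont)).union
      (isClosed_le continuous_const hcont1))
  have hTC : T ∈ C := ⟨⟨hT, le_rfl⟩, Or.inr (by
    have h := hgrow T hT
    rw [hTdef, mul_div_cancel₀ _ hc.ne', ← hTdef] at h
    exact (le_abs_self l).trans (by linarith))⟩
  obtain ⟨τ, ⟨hτ, hτC⟩, hmin⟩ := hC.exists_isLeast ⟨T, hTC⟩
  have hsw : ∀ t, 0 ≤ t → (trajOf α x0 u v t ∈ (sigmaStar α l).switch ↔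
      trajOf α x0 u v t 1 = spread α (trajOf α x0 u v t) ∨ l ≤ trajOf α x0 u v t 1) := fun t ht =>
    or_congr_left (VII_eq_zero_iff hα (h1.trans_le (hy t ht)))
  refine ⟨playOf α x0 u v τ hu hv hu' hv' (by exact_mod_cast hτ.1), rfl, ?_, ?_, ?_⟩
  · refine Filter.Eventually.of_forall fun t ht hact => hfol t ht ?_
    have h := le_spread_of_mem_XII hα (hact.2 t ⟨ht, le_rfl⟩).1
    refine le_trans ?_ (spread_le_norm_zeta hα _)
    exact mul_le_mul_of_nonneg_left ((hy t ht).trans h) hb.le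
  · intro t ht
    obtain rfl : τ = t := WithTop.coe_injective ht
    exact (hsw τ hτ.1).2 hτC
  · intro t ht htτ hmem
    have htτ : t < τ := WithTop.coe_lt_coe.1 htτ
    exact absurd (hmin ⟨⟨ht, htτ.le.trans hτ.2⟩, (hsw t ht).1 hmem⟩) (not_le.2 htτ)

/-- A heading of the Defender that agrees with `psiStar` along its own trajectory as long as the
Intruder is outside the retreat region and safe retreat is possible. -/
theorem exists_defender_heading {α : ℝ} (hα : 1 < α) (x0 : State) {u : ℝ → ℝ} (hu : Measurable u) :
    ∃ v : ℝ → ℝ, Measurable v ∧ (∀ t, v t ∈ headings) ∧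
      ∀ t, 0 ≤ t → (∀ s ∈ Icc 0 t, 0 < trajOf α x0 u v s 1 ∧
        trajOf α x0 u v s 1 ≤ spread α (trajOf α x0 u v s)) →
        v t = psiStar α (trajOf α x0 u v t) := by
  have hb := sq_sub_one_pos hα
  have h0 : 0 < α := by linarith
  set X : ℝ → State := trajOf α x0 u (fun _ => 0)
  have hX : ∀ i, Continuous fun t => X t i := continuous_trajOf hα x0 hu measurable_const
  -- The Intruder may descend to height 0, where the truncation level degenerates; hence an interval
  -- possibly open at its right end, and a Lipschitz constant for each compact part.
  let A : Set ℝ := {t | 0 ≤ t ∧ ∀ s ∈ Icc 0 t, 0 < X s 1}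
  have hA : IsTimeInterval A := ⟨fun t ht => ht.1, fun t ht s hs hst =>
    ⟨hs, fun r hr => ht.2 r ⟨hr.1, hr.2.trans hst⟩⟩⟩
  -- Safety gives ‖`zeta`‖ ≥ 2ε; the factor 1/2 supplies the strict inequality for the first-exit
  -- argument.
  let ε : ℝ → ℝ := fun t => (α ^ 2 - 1) * X t 1 / 2
  have hεc : Continuous ε := (continuous_const.mul (hX 1)).div_const 2
  have hε : ∀ t ∈ A, 0 < ε t := fun t ht =>
    half_pos (mul_pos hb (ht.2 t ⟨ht.1, le_rfl⟩))
  let f : ℝ → ℂ → ℂ := fun t d => α • ((max (ε t) ‖zetaVec α (X t 0 - d.re) d.im‖)⁻¹ •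
    zetaVec α (X t 0 - d.re) d.im)
  obtain ⟨q, hqc, hfc, hq⟩ := exists_integral_solution hA (f := f) (M := α.toNNReal)
    (fun t d => by
      rw [norm_smul, Real.norm_eq_abs, abs_of_pos h0, Real.coe_toNNReal _ h0.le]
      exact mul_le_of_le_one_right h0.le (norm_inv_max_smul_le _ _))
    (fun T hT => by
      obtain ⟨r, hr, hmin⟩ := isCompact_Icc.exists_isMinOn (nonempty_Icc.2 hT.1) hεc.continuousOn
      have hεr := hε r (hA.Icc_subset hT hr)
      refine ⟨(α * (2 / ε r * (α + (α ^ 2 - 1) / α))).toNNReal, fun t ht =>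
        LipschitzWith.of_dist_le_mul fun d e => ?_⟩
      have hεt := hε t (hA.Icc_subset hT ht)
      have hrt : ε r ≤ ε t := hmin ht
      have h1 := (lipschitzWith_inv_max_smul (E := ℂ) hεt).dist_le_mul
        (zetaVec α (X t 0 - d.re) d.im) (zetaVec α (X t 0 - e.re) e.im)
      have h2 := dist_zetaVec_le hα (X t 0 - d.re) d.im (X t 0 - e.re) e.im
      have h3 : |X t 0 - d.re - (X t 0 - e.re)| ≤ dist d e := by
        rw [sub_sub_sub_cancel_left, abs_sub_comm, ← Complex.sub_re, dist_eq_norm]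
        exact Complex.abs_re_le_norm _
      have h4 : |d.im - e.im| ≤ dist d e := by
        rw [← Complex.sub_im, dist_eq_norm]
        exact Complex.abs_im_le_norm _
      rw [Real.coe_toNNReal _ (by positivity)]
      rw [Real.coe_toNNReal _ (by positivity)] at h1
      rw [dist_smul₀, Real.norm_eq_abs, abs_of_pos h0, mul_assoc, mul_assoc]
      gcongr
      refine h1.trans ?_
      gcongr
      refine h2.trans ?_
      rw [add_mul]
      gcongr)
    (fun d => by
      have hz : ContinuousOn (fun t => zetaVec α (X t 0 - d.re) d.im) A :=
        continuousOn_zetaVec α ((hX 0).continuousOn.sub continuousOn_const) continuousOn_const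
      have hm : ContinuousOn (fun t => max (ε t) ‖zetaVec α (X t 0 - d.re) d.im‖) A :=
        continuous_max.comp_continuousOn (hεc.continuousOn.prodMk hz.norm)
      exact ((hm.inv₀ fun t ht => ((hε t ht).trans_le (le_max_left _ _)).ne').smul hz).const_smul α)
    ⟨x0 2, x0 3⟩
  let z : ℝ → ℂ := fun t => zetaVec α (X t 0 - (q t).re) (q t).im
  have hzc : ContinuousOn z A := continuousOn_zetaVec α
    ((hX 0).continuousOn.sub (Complex.continuous_re.comp_continuousOn hqc))
    (Complex.continuous_im.comp_continuousOn hqc)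
  classical
  let g : ℝ → ℂ := A.piecewise z fun _ => 0
  have hg : Measurable g := hzc.measurable_piecewise continuousOn_const hA.measurableSet
  let v : ℝ → ℝ := fun t => Complex.arg (g t)
  have hgz : ∀ t ∈ A, g t = z t := fun t ht => piecewise_eq_of_mem _ _ _ ht
  -- Until the truncation first acts, `q` moves with speed α in the direction of `z`, so it is the
  -- Defender's actual position under `v`.
  have hcoin : ∀ r ∈ A, (∀ s ∈ Ico 0 r, 0 < ‖z s‖ - ε s) →
      zeta α (trajOf α x0 u v r) = z r := by
    intro r hr hs
    have hfi : IntervalIntegrable (fun s => f s (q s)) volume 0 r :=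
      ContinuousOn.intervalIntegrable (by
        rw [uIcc_of_le hr.1]; exact hfc.mono (hA.Icc_subset hr))
    have hfv : ∀ s ∈ Ico 0 r, (f s (q s)).re = α * Real.cos (v s) ∧
        (f s (q s)).im = α * Real.sin (v s) := by
      intro s hsr
      have hsA := hA.Icc_subset hr ⟨hsr.1, hsr.2.le⟩
      have hlt := sub_pos.1 (hs s hsr)
      have hz0 : 0 < ‖z s‖ := (hε s hsA).trans hlt
      have hfs : f s (q s) = α • (‖z s‖⁻¹ • z s) := by
        simp only [f]
        rw [max_eq_right hlt.le]
      rw [hfs]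
      simp only [v, hgz s hsA, Complex.cos_arg (norm_pos_iff.1 hz0), Complex.sin_arg,
        Complex.smul_re, Complex.smul_im, smul_eq_mul]
      constructor <;> ring
    have hre : trajOf α x0 u v r 2 = (q r).re := by
      rw [hq r hr, Complex.add_re, ← Complex.reCLM_apply (∫ s in (0 : ℝ)..r, f s (q s)),
        ← ContinuousLinearMap.intervalIntegral_comp_comm _ hfi]
      change x0 2 + ∫ s in (0 : ℝ)..r, α * Real.cos (v s) = _
      congr 1
      refine intervalIntegral.integral_congr_Ioo_of_le hr.1 fun s hs' => ?_
      exact (hfv s (Ioo_subset_Ico_self hs')).1.symm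
    have him : trajOf α x0 u v r 3 = (q r).im := by
      rw [hq r hr, Complex.add_im, ← Complex.imCLM_apply (∫ s in (0 : ℝ)..r, f s (q s)),
        ← ContinuousLinearMap.intervalIntegral_comp_comm _ hfi]
      change x0 3 + ∫ s in (0 : ℝ)..r, α * Real.sin (v s) = _
      congr 1
      refine intervalIntegral.integral_congr_Ioo_of_le hr.1 fun s hs' => ?_
      exact (hfv s (Ioo_subset_Ico_self hs')).2.symm
    rw [zeta_eq_zetaVec, hre, him]
    rfl
  refine ⟨v, Complex.measurable_arg.comp hg, fun t => arg_mem_headings _, fun t ht hsafe => ?_⟩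
  have htA : t ∈ A := ⟨ht, fun s hs => (hsafe s hs).1⟩
  have hpos : ∀ s ∈ Icc 0 t, 0 < ‖z s‖ - ε s := by
    refine pos_of_forall_first_exit ((hzc.norm.sub hεc.continuousOn).mono (hA.Icc_subset htA))
      fun r hr hs => ?_
    rw [← hcoin r (hA.Icc_subset htA hr) hs]
    obtain ⟨h1, h2⟩ := hsafe r hr
    have h3 := spread_le_norm_zeta hα (trajOf α x0 u v r)
    have h4 : (α ^ 2 - 1) * trajOf α x0 u v r 1 ≤
      (α ^ 2 - 1) * spread α (trajOf α x0 u v r) := mul_le_mul_of_nonneg_left h2 hb.le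
    have h5 : ε r = (α ^ 2 - 1) * trajOf α x0 u v r 1 / 2 := rfl
    have h6 := mul_pos hb h1
    linarith
  obtain ⟨h1, h2⟩ := hsafe t ⟨ht, le_rfl⟩
  rw [psiStar_eq hα (h1.trans_le h2), hcoin t htA fun s hs => hpos s ⟨hs.1, hs.2.le⟩, ← hgz t htA]

theorem exists_play_defenderFollows {α : ℝ} (hα : 1 < α) {x0 : State}
    {u : ℝ → ℝ} {ts : WithTop ℝ} (hu : Measurable u) (hu' : ∀ t, u t ∈ headings) (hts : 0 ≤ ts) :
    ∃ p : Play α x0, p.u = u ∧ p.ts = ts ∧ p.DefenderFollows (psiStar α) := by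
  obtain ⟨v, hv, hv', hfol⟩ := exists_defender_heading hα x0 hu
  refine ⟨playOf α x0 u v ts hu hv hu' hv' hts, rfl, rfl,
    Filter.Eventually.of_forall fun t ht hact => hfol t ht fun s hs => ?_⟩
  exact ⟨(hact.2 s hs).2, le_spread_of_mem_XII hα (hact.2 s hs).1⟩

/-- Along the equilibrium headings the vector from the Defender to the Intruder and the height of
the Defender shrink at the same rate. -/
theorem exists_play_both {α l : ℝ} (hα : 1 < α) {x0 : State} (hx : x0 ∈ XI α l) (h1 : 0 < x0 1) :
    ∃ p : Play α x0, p.IntruderFollows (sigmaStar α l) ∧ p.DefenderFollows (psiStar α) := by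
  have hb := sq_sub_one_pos hα
  have h0 : 0 < α := by linarith
  have hle := le_spread_of_mem_XII hα hx.1
  have hS : 0 < spread α x0 := h1.trans_le hle
  have hN := norm_zeta_pos hα hS
  set N := ‖zeta α x0‖ with hNdef
  set S := spread α x0 with hSdef
  have hVI : 0 ≤ l - 1 / 2 * (x0 1 + S) := hx.2
  -- The time at which the linearly growing y_I meets the linearly shrinking `spread`, both being
  -- then (y_I + `spread`)/2 of the initial state.
  set τ := (S - x0 1) * N / (2 * (α ^ 2 - 1) * S) with hτdef
  have hτ : 0 ≤ τ := div_nonneg (mul_nonneg (sub_nonneg.2 hle) hN.le) (by positivity)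
  -- Headings frozen at their initial values: the common factor `r` cancels in `Lam` and in the
  -- argument of `zeta`, so the frozen headings are the feedback headings.
  let p : Play α x0 := playOf α x0 (fun _ => phiStar α x0) (fun _ => psiStar α x0) τ
    measurable_const measurable_const (fun _ => arg_mem_headings _) (fun _ => arg_mem_headings _)
    (by exact_mod_cast hτ)
  have htr : ∀ t i, p.traj t i = x0 i + t * field α (phiStar α x0) (psiStar α x0) i := by
    intro t i
    simp [p, playOf, trajOf]
  have hcφ : Real.cos (phiStar α x0) = (x0 0 - x0 2) / N := by
    rw [cos_phiStar hα, Lam_eq hα]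
  have hsφ : Real.sin (phiStar α x0) = (α ^ 2 - 1) * S / N := by
    rw [sin_phiStar hα, sqrt_one_sub_Lam_sq hα hS]
  have hcψ : Real.cos (psiStar α x0) = α * (x0 0 - x0 2) / N := by
    rw [psiStar_eq hα hS, Complex.cos_arg (norm_pos_iff.1 hN)]; rfl
  have hsψ : Real.sin (psiStar α x0) = -((α ^ 2 - 1) / α * x0 3) / N := by
    rw [psiStar_eq hα hS, Complex.sin_arg]; rfl
  let r : ℝ → ℝ := fun t => 1 - t * (α ^ 2 - 1) / N
  have hd : ∀ t, p.traj t 0 - p.traj t 2 = r t * (x0 0 - x0 2) := fun t => by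
    rw [htr, htr]
    simp only [field, Matrix.cons_val, hcφ, hcψ, r]
    field_simp
    ring
  have hD : ∀ t, p.traj t 3 = r t * x0 3 := fun t => by
    rw [htr]
    simp only [field, Matrix.cons_val, hsψ, r]
    field_simp
    ring
  have hy : ∀ t, p.traj t 1 = x0 1 + t * ((α ^ 2 - 1) * S / N) := fun t => by
    rw [htr]
    simp only [field, Matrix.cons_val, hsφ]
  have hrτ : r τ = (S + x0 1) / (2 * S) := by
    simp only [r, hτdef]
    field_simp
    ring
  have hr : ∀ t, t ≤ τ → 0 < r t := fun t ht => by
    have h : r τ ≤ r t := by simp only [r]; gcongr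
    exact lt_of_lt_of_le (by rw [hrτ]; positivity) h
  have hspread : ∀ t, t ≤ τ → spread α (p.traj t) = r t * S := fun t ht => by
    rw [← abs_of_pos (hr t ht), ← abs_of_pos hS, ← abs_mul,
      ← abs_of_nonneg (spread_nonneg α (p.traj t)), ← sq_eq_sq_iff_abs_eq_abs, mul_pow,
      spread_sq hα, hSdef, spread_sq hα, hd, hD]
    ring
  have hzeta : ∀ t, zeta α (p.traj t) = (r t : ℂ) * zeta α x0 := fun t => by
    apply Complex.ext
    · rw [Complex.re_ofReal_mul]; simp only [zeta, hd]; ring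
    · rw [Complex.im_ofReal_mul]; simp only [zeta, hD]; ring
  have hLam : ∀ t, t ≤ τ → Lam α (p.traj t) = Lam α x0 := fun t ht => by
    have := hr t ht
    rw [Lam_eq hα, Lam_eq hα, hzeta, hd, norm_mul, Complex.norm_real, Real.norm_eq_abs,
      abs_of_pos this, mul_div_mul_left _ _ this.ne']
  have hyτ : p.traj τ 1 = (x0 1 + S) / 2 := by
    rw [hy, hτdef]
    field_simp
    ring
  have hSτ : spread α (p.traj τ) = (x0 1 + S) / 2 := by
    rw [hspread τ le_rfl, hrτ]
    field_simp
    ring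
  have hyt : ∀ t, t < τ → p.traj t 1 < (x0 1 + S) / 2 := fun t ht => by
    rw [← hyτ, hy, hy]
    gcongr
  have hSt : ∀ t, t < τ → (x0 1 + S) / 2 < spread α (p.traj t) := fun t ht => by
    rw [← hSτ, hspread t ht.le, hspread τ le_rfl]
    simp only [r]
    gcongr
  have hlt : ∀ t, p.Active t → t < τ := fun t h => WithTop.coe_lt_coe.1 h.1
  refine ⟨p, ⟨Filter.Eventually.of_forall fun t _ hact => ?_, fun t ht => ?_, fun t ht htτ => ?_⟩,
    Filter.Eventually.of_forall fun t _ hact => ?_⟩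
  · change phiStar α x0 = phiStar α (p.traj t)
    rw [phiStar, phiStar, hLam t (hlt t hact).le]
  · obtain rfl : τ = t := WithTop.coe_injective ht
    exact Or.inl (VII_eq_zero hα (by rw [hyτ]; positivity) (hyτ.trans hSτ.symm))
  · have htτ : t < τ := WithTop.coe_lt_coe.1 htτ
    have hpos : 0 < p.traj t 1 := by rw [hy]; positivity
    rintro (h | h)
    · rw [VII_eq_zero_iff hα hpos] at h
      linarith [hyt t htτ, hSt t htτ]
    -- Before `τ` the height is below (y_I + `spread`)/2 of the initial state, which is at most l
    -- because `VI` ≥ 0 there.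
    · have h : l ≤ p.traj t 1 := h
      linarith [hyt t htτ]
  · change psiStar α x0 = psiStar α (p.traj t)
    have h := hlt t hact
    rw [psiStar_eq hα hS, psiStar_eq hα (by rw [hspread t h.le]; exact mul_pos (hr t h.le) hS),
      hzeta, Complex.arg_real_mul _ (hr t h.le)]

/-! ### The value of the approach game -/

theorem isSaddlePoint {α l : ℝ} (hα : 1 < α) {x : State} (hx : x ∈ XI α l) (h1 : 0 < x 1) :
    IsSaddlePoint α l x (sigmaStar α l) (psiStar α) (VI α l x) where
  intruder_play := fun _ hv hv' => exists_play_intruderFollows hα h1 hv hv'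
  defender_play := fun _ _ hu hu' hts => exists_play_defenderFollows hα hu hu' hts
  intruder_le := fun p hp => p.payoff_le_of_intruderFollows hα hx h1 hp
  le_defender := fun p hp => p.le_payoff_of_defenderFollows hα hp
  outcomes_eq := by
    refine Subset.antisymm ?_ ?_
    · rintro _ ⟨p, hI, hD, rfl⟩
      exact le_antisymm (p.payoff_le_of_intruderFollows hα hx h1 hI)
        (p.le_payoff_of_defenderFollows hα hD)
    · rintro _ rfl
      obtain ⟨p, hI, hD⟩ := exists_play_both hα hx h1
      exact ⟨p, hI, hD, le_antisymm (p.payoff_le_of_intruderFollows hα hx h1 hI)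
        (p.le_payoff_of_defenderFollows hα hD)⟩

/-- Compatibility excludes empty outcome sets, whose `sSup` is ⊥ and whose `sInf` is ⊤ and which
would spoil the comparison with the saddle strategies. -/
theorem IsSaddlePoint.isValueOn {α l V : ℝ} {x : State} {σ : IntruderStrategy}
    {ψ : DefenderStrategy} (h : IsSaddlePoint α l x σ ψ V) {𝓘 : Set IntruderStrategy}
    {𝓓 : Set DefenderStrategy} (hσ : σ ∈ 𝓘) (hψ : ψ ∈ 𝓓) (hc : Compatible α l x 𝓘 𝓓) :
    IsValueOn α l x 𝓘 𝓓 V := by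
  constructor
  · apply le_antisymm
    · refine (iInf₂_le σ hσ).trans (iSup₂_le fun ψ' _ => sSup_le ?_)
      rintro _ ⟨p, hI, -, rfl⟩
      exact h.intruder_le p hI
    · refine le_iInf₂ fun σ' hσ' => ?_
      obtain ⟨c, hcm⟩ := hc σ' hσ' ψ hψ
      obtain ⟨p, -, hD, rfl⟩ := id hcm
      exact (h.le_defender p hD).trans ((le_sSup hcm).trans
        (le_iSup₂ (f := fun ψ _ => sSup (outcomes α l x σ' ψ)) ψ hψ))
  · apply le_antisymm
    · refine iSup₂_le fun ψ' hψ' => ?_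
      obtain ⟨c, hcm⟩ := hc σ hσ ψ' hψ'
      obtain ⟨p, hI, -, rfl⟩ := id hcm
      exact ((iInf₂_le (f := fun σ _ => sInf (outcomes α l x σ ψ')) σ hσ).trans
        (sInf_le hcm)).trans (h.intruder_le p hI)
    · refine le_trans (le_iInf₂ fun σ' _ => le_sInf ?_)
        (le_iSup₂ (f := fun ψ _ => ⨅ σ ∈ 𝓘, sInf (outcomes α l x σ ψ)) ψ hψ)
      rintro _ ⟨p, -, hD, rfl⟩
      exact h.le_defender p hD

end Recon

end

theorem theorem2 (α l : ℝ) (hα : 1 < α) (hl : 0 < l) :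
    ∀ x ∈ Recon.XI α l, 0 < x 1 →
      Recon.IsSaddlePoint α l x (Recon.sigmaStar α l) (Recon.psiStar α) (Recon.VI α l x) ∧
      (∀ (𝓘 : Set Recon.IntruderStrategy) (𝓓 : Set Recon.DefenderStrategy),
        Recon.sigmaStar α l ∈ 𝓘 → Recon.psiStar α ∈ 𝓓 → Recon.Compatible α l x 𝓘 𝓓 →
        Recon.IsValueOn α l x 𝓘 𝓓 (Recon.VI α l x)) ∧
      ContDiffAt ℝ 1 (Recon.VI α l) x ∧
      Recon.HJI α (Recon.VI α l) x := by
  intro x hx h1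
  have hS : 0 < Recon.spread α x := h1.trans_le (Recon.le_spread_of_mem_XII hα hx.1)
  have hsp := Recon.isSaddlePoint hα hx h1
  exact ⟨hsp, fun 𝓘 𝓓 hσ hψ hc => hsp.isValueOn hσ hψ hc, Recon.contDiffAt_VI l hS,
    Recon.hji hα l hS⟩
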